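/- For positive integers $d,n$ and a real number $r>0$, let $G_d(n,r)$ be the random geometric graph on vertex set $[n]=\{1,\dots,n\}$ obtained from independent uniform random points $X_1,\dots,X_n$ of $[0,1]^d$ by joining distinct $i,j$ if and only if $\lVert X_i-X_j\rVert\le r$ (Euclidean distance). For $\alpha\in[0,1]$, an $\alpha$-subgraph of a graph $G$ is a spanning subgraph $H\subseteq G$ with $d_H(v)\ge\alpha\, d_G(v)$ for every vertex $v$. For an integer $k\ge 1$, a graph $G$ is $k$-connected if $|V(G)|>k$ and $G-U$ is connected for every $U\subseteq V(G)$ with $|U|<k$; for real $k>0$, $k$-connected means $\lceil k\rceil$-connected. A.a.s. means with probability tending to $1$ as $n\to\infty$. There is an absolute constant $K>0$ such that the following holds. For every $\epsilon\in(0,1/2]$ and every integer $d\ge1$, there are constants $c_1=c_1(d,\epsilon)>0$ and $C_1=C_1(d,\epsilon)>0$, where $C_1=K\epsilon^{-2/d}\sqrt d$, such that for every sequence $r=r(n)$ with $C_1(\log n/n)^{1/d}\le r\le\sqrt d$ for all sufficiently large $n$, a.a.s. every $(1/2+\epsilon)$-subgraph of $G_d(n,r)$ is $(c_1r^dn)$-connected.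 In particular, for every sequence $r=r(n)$ with $r\ge C_1(\log n/n)^{1/d}$ for all sufficiently large $n$, a.a.s. every $(1/2+\epsilon)$-subgraph of $G_d(n,r)$ is connected. -/

import Mathlib

open MeasureTheory Filter Topology

namespace RGG

/-- The unit cube `[0,1]^d` in Euclidean space. -/
def unitCube (d : ℕ) : Set (EuclideanSpace ℝ (Fin d)) :=
  {x | ∀ i, x i ∈ Set.Icc (0 : ℝ) 1}

/-- The uniform distribution on `[0,1]^d`: Lebesgue measure restricted to the cube, which has
volume one. -/
noncomputable def uniformCube (d : ℕ) : Measure (EuclideanSpace ℝ (Fin d)) :=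
  volume.restrict (unitCube d)

/-- The joint law of `n` independent uniform points of `[0,1]^d`. -/
noncomputable def pointsLaw (d n : ℕ) : Measure (Fin n → EuclideanSpace ℝ (Fin d)) :=
  Measure.pi fun _ => uniformCube d

/-- The geometric graph of a labelled family of points: distinct labels are adjacent when their
points are at Euclidean distance at most `r`. The random geometric graph `G_d(n,r)` is
`geomGraph X r` for `X` distributed according to `pointsLaw d n`. -/
def geomGraph {d n : ℕ} (X : Fin n → EuclideanSpace ℝ (Fin d)) (r : ℝ) :
    SimpleGraph (Fin n) where
  Adj i j := i ≠ j ∧ dist (X i) (X j) ≤ r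
  symm := ⟨fun i j h => ⟨h.1.symm, by rw [dist_comm]; exact h.2⟩⟩
  loopless := ⟨fun _ h => h.1 rfl⟩

/-- `H` is an `α`-subgraph of `G`: `H ⊆ G` on the same vertices, and
`d_H(v) ≥ α d_G(v)` for every vertex `v`. -/
def IsAlphaSubgraph {V : Type*} (α : ℝ) (H G : SimpleGraph V) : Prop :=
  H ≤ G ∧ ∀ v, α * ((G.neighborSet v).ncard : ℝ) ≤ ((H.neighborSet v).ncard : ℝ)

/-- `G` is `k`-connected: it has more than `k` vertices, and deleting any fewer than `k` vertices
leaves a connected graph. -/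
def IsKConnected {V : Type*} [Fintype V] (G : SimpleGraph V) (k : ℕ) : Prop :=
  k < Fintype.card V ∧
    ∀ U : Finset V, U.card < k → (G.induce ((U : Set V)ᶜ)).Connected

/-- The radius bound `C (log n / n)^{1/d}`. -/
noncomputable def radiusBound (C : ℝ) (d n : ℕ) : ℝ :=
  C * (Real.log n / n) ^ ((1 : ℝ) / d)

/-- A property of the random geometric graph `G_d(n, r n)` holds asymptotically almost surely: its
probability tends to one as `n → ∞`. -/
def AAS (d : ℕ) (r : ℕ → ℝ) (P : (n : ℕ) → SimpleGraph (Fin n) → Prop) : Prop :=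
  Tendsto (fun n => pointsLaw d n {X | P n (geomGraph X (r n))}) atTop (𝓝 1)

theorem volume_unitCube (d : ℕ) : volume (unitCube d) = 1 := by
  have h := (PiLp.volume_preserving_ofLp (Fin d)).measure_preimage
    (s := Set.univ.pi fun _ : Fin d => Set.Icc (0 : ℝ) 1)
    (MeasurableSet.univ_pi fun _ => measurableSet_Icc).nullMeasurableSet
  have e : unitCube d =
      WithLp.ofLp ⁻¹' (Set.univ.pi fun _ : Fin d => Set.Icc (0 : ℝ) 1) := by
    ext x
    simp only [unitCube, Set.mem_setOf_eq, Set.mem_preimage, Set.mem_pi, Set.mem_univ,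
      true_imp_iff]
  rw [e, h, volume_pi_pi]
  simp

instance instProbUniformCube (d : ℕ) : IsProbabilityMeasure (uniformCube d) :=
  ⟨by rw [uniformCube, Measure.restrict_apply_univ, volume_unitCube]⟩

instance instProbPointsLaw (d n : ℕ) : IsProbabilityMeasure (pointsLaw d n) := by
  unfold pointsLaw
  infer_instance

end RGG

/-!
Cut the cube into cells of mesh a small multiple of `r`. By Chernoff bounds and a union bound over
the boundedly many unions of cells near each of the `O(n)` cells, all of these contain about the
expected number of points; this is the only use of randomness.

Suppose that deleting few vertices from a `(1/2 + ε)`-subgraph leaves a cut `A ∪ B` with no edges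
across. The ball of radius `r` around a point of `A` then contains clearly more points of `A` than
of `B`, and vice versa. The imbalance varies slowly with the centre, so the segment between a
point of `A` and a point of `B` passes through a balanced place, and no point of `A ∪ B` is close
to a balanced place; hence the balanced places are covered by cells of tiny total volume within a
ball of radius `2r`. But around a balanced place both `A` and `B` occupy cells of volume of order
`r ^ d`, and every segment from one to the other meets the balanced cells at one of boundedly many
division points. Since `(x, y) ↦ (1 - s) x + s y` is non-degenerate in `x` or in `y`, this forces
the balanced cells to have volume of order `r ^ d` as well, a contradiction.
-/

namespace RGG

theorem rpow_self_mul_exp_neg_le_Gamma {x : ℝ} (hx : 0 ≤ x) :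
    x ^ x * Real.exp (-x) ≤ Real.Gamma (x + 1) := by
  have hint := Real.GammaIntegral_convergent (s := x + 1) (by linarith)
  have hsub : Set.Ioi x ⊆ Set.Ioi 0 := Set.Ioi_subset_Ioi hx
  calc x ^ x * Real.exp (-x) = ∫ t in Set.Ioi x, Real.exp (-t) * x ^ x := by
        rw [integral_mul_const, integral_exp_neg_Ioi, mul_comm]
    _ ≤ ∫ t in Set.Ioi x, Real.exp (-t) * t ^ (x + 1 - 1) := by
        refine setIntegral_mono_on ((integrableOn_exp_neg_Ioi x).mul_const _)
          (hint.mono_set hsub) measurableSet_Ioi fun t ht => ?_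
        rw [add_sub_cancel_right]
        have hxt : x ≤ t := le_of_lt ht
        gcongr
    _ ≤ ∫ t in Set.Ioi 0, Real.exp (-t) * t ^ (x + 1 - 1) := by
        refine setIntegral_mono_set hint ?_ hsub.eventuallyLE
        filter_upwards [ae_restrict_mem measurableSet_Ioi] with t ht
        exact mul_nonneg (Real.exp_pos _).le (Real.rpow_nonneg (le_of_lt ht) _)
    _ = Real.Gamma (x + 1) := (Real.Gamma_eq_integral (by linarith)).symm

theorem sqrt_pow_le_Gamma (d : ℕ) :
    √(d / (2 * Real.exp 1)) ^ d ≤ Real.Gamma ((d : ℝ) / 2 + 1) := by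
  refine le_trans (le_of_eq ?_) (rpow_self_mul_exp_neg_le_Gamma (x := (d : ℝ) / 2) (by positivity))
  have hexp : Real.exp (-((d : ℝ) / 2)) = (Real.exp 1)⁻¹ ^ ((d : ℝ) / 2) := by
    rw [← Real.exp_neg, ← Real.exp_mul, neg_one_mul]
  rw [hexp, ← Real.mul_rpow (by positivity) (by positivity), Real.sqrt_eq_rpow,
    ← Real.rpow_mul_natCast (by positivity)]
  congr 1 <;> field_simp

/-- The volume of a cube of diameter `r` in `ℝ^d`, the unit in which all volumes and expected
numbers of points are measured. -/
noncomputable def cubeVolume (d : ℕ) (r : ℝ) : ℝ := (r / √d) ^ d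

theorem cubeVolume_pos (d : ℕ) [NeZero d] {r : ℝ} (hr : 0 < r) : 0 < cubeVolume d r := by
  have : 0 < d := NeZero.pos d
  unfold cubeVolume
  positivity

theorem cubeVolume_mul (d : ℕ) (s r : ℝ) : cubeVolume d (s * r) = s ^ d * cubeVolume d r := by
  rw [cubeVolume, cubeVolume, mul_div_assoc, mul_pow]

theorem volumeReal_closedBall_le {d : ℕ} [NeZero d] (x : EuclideanSpace ℝ (Fin d)) {r : ℝ}
    (hr : 0 ≤ r) : volume.real (Metric.closedBall x r) ≤ 5 ^ d * cubeVolume d r := by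
  have hd : (0 : ℝ) < d := Nat.cast_pos.2 (NeZero.pos d)
  have hpi : √Real.pi * √d ≤ 5 * √(d / (2 * Real.exp 1)) := by
    rw [← Real.sqrt_mul Real.pi_nonneg, show (5 : ℝ) = √(5 ^ 2) by norm_num,
      ← Real.sqrt_mul (by positivity)]
    refine Real.sqrt_le_sqrt ?_
    rw [mul_div_assoc', le_div_iff₀ (by positivity)]
    have hconst : Real.pi * (2 * Real.exp 1) ≤ 3.15 * (2 * 2.7182818286) := by
      gcongr
      exacts [Real.pi_lt_d2.le, Real.exp_one_lt_d9.le]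
    nlinarith
  have hGamma_pos : 0 < Real.Gamma ((d : ℝ) / 2 + 1) := Real.Gamma_pos_of_pos (by positivity)
  have hGamma : √Real.pi ^ d / Real.Gamma ((d : ℝ) / 2 + 1) ≤ 5 ^ d / √d ^ d := by
    rw [div_le_div_iff₀ hGamma_pos (by positivity)]
    calc √Real.pi ^ d * √d ^ d ≤ 5 ^ d * √(d / (2 * Real.exp 1)) ^ d := by
          rw [← mul_pow, ← mul_pow]; gcongr
      _ ≤ 5 ^ d * Real.Gamma ((d : ℝ) / 2 + 1) := by gcongr; exact sqrt_pow_le_Gamma d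
  rw [measureReal_def, EuclideanSpace.volume_closedBall, ENNReal.toReal_mul, ENNReal.toReal_pow,
    ENNReal.toReal_ofReal hr, Fintype.card_fin, ENNReal.toReal_ofReal (by positivity)]
  calc r ^ d * (√Real.pi ^ d / Real.Gamma ((d : ℝ) / 2 + 1)) ≤ r ^ d * (5 ^ d / √d ^ d) := by gcongr
    _ = 5 ^ d * cubeVolume d r := by rw [cubeVolume, div_pow]; ring

theorem measurableSet_unitCube (d : ℕ) : MeasurableSet (unitCube d) := by
  have h : unitCube d = ⋂ i, (fun x : EuclideanSpace ℝ (Fin d) => x i) ⁻¹' Set.Icc 0 1 := by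
    ext x; simp only [unitCube, Set.mem_ofPred_eq, Set.mem_iInter, Set.mem_preimage]
  rw [h]
  exact MeasurableSet.iInter fun i => by measurability

theorem convex_unitCube (d : ℕ) : Convex ℝ (unitCube d) := fun x hx y hy a b ha hb hab i => by
  simpa using convex_Icc (0 : ℝ) 1 (hx i) (hy i) ha hb hab

theorem dist_le_sqrt_mul_of_forall_abs_le {d : ℕ} {x y : EuclideanSpace ℝ (Fin d)} {c : ℝ}
    (hc : 0 ≤ c) (h : ∀ i, |x i - y i| ≤ c) : dist x y ≤ √d * c := by
  calc dist x y = √(∑ i, |x i - y i| ^ 2) := EuclideanSpace.dist_eq x y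
    _ ≤ √(∑ _i : Fin d, c ^ 2) := by gcongr with i; exact h i
    _ = √d * c := by simp [Real.sqrt_sq hc]

theorem dist_le_sqrt_of_mem_unitCube {d : ℕ} {x y : EuclideanSpace ℝ (Fin d)}
    (hx : x ∈ unitCube d) (hy : y ∈ unitCube d) : dist x y ≤ √d := by
  simpa using dist_le_sqrt_mul_of_forall_abs_le zero_le_one
    fun i => (abs_sub_le_of_le_of_le (hx i).1 (hx i).2 (hy i).1 (hy i).2).trans_eq (sub_zero 1)

-- The homothety about `x` that shrinks the cube to diameter `r` maps it into the intersection.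
theorem cubeVolume_le_volumeReal_closedBall_inter_unitCube {d : ℕ} [NeZero d]
    {x : EuclideanSpace ℝ (Fin d)} (hx : x ∈ unitCube d) {r : ℝ} (hr : 0 ≤ r) (hr' : r ≤ √d) :
    cubeVolume d r ≤ volume.real (Metric.closedBall x r ∩ unitCube d) := by
  have hd : 0 < √(d : ℝ) := Real.sqrt_pos.2 (Nat.cast_pos.2 (NeZero.pos d))
  have ht0 : 0 ≤ r / √d := by positivity
  have ht1 : r / √d ≤ 1 := (div_le_one hd).2 hr'
  have hsub : AffineMap.homothety x (r / √d) '' unitCube d ⊆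
      Metric.closedBall x r ∩ unitCube d := by
    rintro _ ⟨y, hy, rfl⟩
    refine ⟨?_, (convex_unitCube d).lineMap_mem hx hy ⟨ht0, ht1⟩⟩
    rw [Metric.mem_closedBall, dist_homothety_center, Real.norm_of_nonneg ht0]
    calc r / √d * dist x y ≤ r / √d * √d := by
          gcongr; exact dist_le_sqrt_of_mem_unitCube hx hy
      _ = r := div_mul_cancel₀ r hd.ne'
  calc cubeVolume d r = volume.real (AffineMap.homothety x (r / √d) '' unitCube d) := by
        rw [measureReal_def, Measure.addHaar_image_homothety, volume_unitCube, mul_one,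
          ENNReal.toReal_ofReal (abs_nonneg _), finrank_euclideanSpace_fin,
          abs_of_nonneg (by positivity), cubeVolume]
    _ ≤ volume.real (Metric.closedBall x r ∩ unitCube d) := measureReal_mono hsub
        (measure_ne_top_of_subset Set.inter_subset_left measure_closedBall_lt_top.ne)

theorem one_add_pow_sub_one_sub_pow_le (d : ℕ) {t : ℝ} (ht0 : 0 ≤ t) (ht1 : t ≤ 1) :
    (1 + t) ^ d - (1 - t) ^ d ≤ 2 * t * 4 ^ d := by
  have hmax : max |1 + t| |1 - t| ≤ 2 := by
    rw [abs_of_nonneg (by linarith), abs_of_nonneg (by linarith)]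
    exact max_le (by linarith) (by linarith)
  have hd : (d : ℝ) ≤ 2 ^ d := mod_cast Nat.lt_two_pow_self.le
  calc (1 + t) ^ d - (1 - t) ^ d
      ≤ |1 + t - (1 - t)| * d * max |1 + t| |1 - t| ^ (d - 1) :=
        (le_abs_self _).trans (abs_pow_sub_pow_le ..)
    _ ≤ 2 * t * 2 ^ d * 2 ^ d := by
        gcongr
        · rw [abs_of_nonneg] <;> linarith
        · exact (pow_le_pow_left₀ (by positivity) hmax _).trans
            (pow_le_pow_right₀ one_le_two (Nat.sub_le d 1))
    _ = 2 * t * 4 ^ d := by rw [mul_assoc, ← mul_pow]; norm_num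

theorem prod_le_mul_of_forall_preimage_le {α β : Type*} [MeasurableSpace α] [MeasurableSpace β]
    {μ : Measure α} {ν : Measure β} [SFinite ν] {P : Set (α × β)} {A : Set α} {c : ENNReal}
    (hA : MeasurableSet A) (hP : MeasurableSet P) (hPA : P ⊆ A ×ˢ Set.univ)
    (h : ∀ a ∈ A, ν (Prod.mk a ⁻¹' P) ≤ c) : μ.prod ν P ≤ μ A * c := by
  rw [Measure.prod_apply hP, mul_comm, ← setLIntegral_const, ← lintegral_indicator hA]
  refine lintegral_mono fun a => ?_
  by_cases ha : a ∈ A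
  · simpa [ha] using h a ha
  · have : Prod.mk a ⁻¹' P = ∅ := Set.eq_empty_of_forall_notMem fun b hb => ha (hPA hb).1
    simp [this]

section Haar

variable {E : Type*} [NormedAddCommGroup E] [NormedSpace ℝ E] [FiniteDimensional ℝ E]
  [MeasurableSpace E] [BorelSpace E] (μ : Measure E) [μ.IsAddHaarMeasure]

theorem measureReal_closedBall_sdiff_closedBall_le (x : E) {r t : ℝ} (hr : 0 ≤ r) (ht0 : 0 ≤ t)
    (ht1 : t ≤ 1) :
    μ.real (Metric.closedBall x ((1 + t) * r) \ Metric.closedBall x ((1 - t) * r)) ≤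
      2 * t * 4 ^ Module.finrank ℝ E * μ.real (Metric.closedBall x r) := by
  have : ProperSpace E := FiniteDimensional.proper_real E
  have hsub : Metric.closedBall x ((1 - t) * r) ⊆ Metric.closedBall x ((1 + t) * r) :=
    Metric.closedBall_subset_closedBall (by gcongr; linarith)
  rw [measureReal_sdiff hsub Metric.isClosed_closedBall.measurableSet measure_closedBall_lt_top.ne,
    Measure.addHaar_real_closedBall μ x (mul_nonneg (by linarith) hr),
    Measure.addHaar_real_closedBall μ x (mul_nonneg (by linarith) hr),
    Measure.addHaar_real_closedBall μ x hr, mul_pow, mul_pow, mul_assoc, mul_assoc, ← sub_mul]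
  gcongr
  exact one_add_pow_sub_one_sub_pow_le _ ht0 ht1

theorem measure_preimage_smul_add_le {s : ℝ} (hs : 1 / 2 ≤ s) (w : E) (M : Set E) :
    μ ((fun x => s • x + w) ⁻¹' M) ≤ 2 ^ Module.finrank ℝ E * μ M := by
  have hs0 : 0 < s := by linarith
  change μ ((s • ·) ⁻¹' ((· + w) ⁻¹' M)) ≤ _
  rw [Measure.addHaar_preimage_smul _ hs0.ne', measure_preimage_add_right,
    abs_of_nonneg (by positivity), ← inv_pow, ENNReal.ofReal_pow (by positivity)]
  gcongr
  refine ENNReal.ofReal_le_of_le_toReal ?_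
  rw [ENNReal.toReal_ofNat, inv_le_comm₀ hs0 two_pos]
  linarith

theorem measurable_lineMap (s : ℝ) :
    Measurable fun p : E × E => AffineMap.lineMap p.1 p.2 s := by
  have : ProperSpace E := FiniteDimensional.proper_real E
  simp only [AffineMap.lineMap_apply_module]
  fun_prop

open AffineMap in
theorem prod_lineMap_mem_le_of_half_le {A B M : Set E} (hA : MeasurableSet A)
    (hB : MeasurableSet B) (hM : MeasurableSet M) {s : ℝ} (hs : 1 / 2 ≤ s) :
    (μ.prod μ) (A ×ˢ B ∩ {p | lineMap p.1 p.2 s ∈ M}) ≤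
      μ A * (2 ^ Module.finrank ℝ E * μ M) := by
  refine prod_le_mul_of_forall_preimage_le hA ((hA.prod hB).inter (measurable_lineMap s hM))
    (fun p hp => ⟨hp.1.1, trivial⟩) fun a _ => ?_
  refine le_trans (measure_mono fun y hy => ?_)
    (measure_preimage_smul_add_le μ hs ((1 - s) • a) M)
  simpa [lineMap_apply_module, add_comm] using hy.2

open AffineMap in
theorem prod_lineMap_mem_le {A B M : Set E} (hA : MeasurableSet A) (hB : MeasurableSet B)
    (hM : MeasurableSet M) (s : ℝ) :
    (μ.prod μ) (A ×ˢ B ∩ {p | lineMap p.1 p.2 s ∈ M}) ≤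
      max (μ A) (μ B) * (2 ^ Module.finrank ℝ E * μ M) := by
  rcases le_total (1 / 2) s with hs | hs
  · refine (prod_lineMap_mem_le_of_half_le μ hA hB hM hs).trans ?_
    gcongr
    exact le_max_left _ _
  · have hmeas : MeasurableSet (A ×ˢ B ∩ {p : E × E | lineMap p.1 p.2 s ∈ M}) :=
      (hA.prod hB).inter (measurable_lineMap s hM)
    have hswap : Prod.swap ⁻¹' (A ×ˢ B ∩ {p : E × E | lineMap p.1 p.2 s ∈ M}) =
        B ×ˢ A ∩ {p | lineMap p.1 p.2 (1 - s) ∈ M} := by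
      ext p; simp [lineMap_apply_one_sub, and_comm]
    rw [← Measure.measurePreserving_swap.measure_preimage hmeas.nullMeasurableSet, hswap]
    refine (prod_lineMap_mem_le_of_half_le μ hB hA hM (by linarith)).trans ?_
    gcongr
    exact le_max_right _ _

-- Double counting of the pairs in `A ×ˢ B` according to the position where the segment meets `M`.
open AffineMap in
theorem min_measure_le_of_lineMap_mem {A B M : Set E} (hA : MeasurableSet A)
    (hB : MeasurableSet B) (hM : MeasurableSet M) (hA' : μ A ≠ ⊤) (hB' : μ B ≠ ⊤) {I : Finset ℝ}
    (h : ∀ x ∈ A, ∀ y ∈ B, ∃ s ∈ I, lineMap x y s ∈ M) :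
    min (μ A) (μ B) ≤ I.card * (2 ^ Module.finrank ℝ E * μ M) := by
  have hcover : A ×ˢ B ⊆ ⋃ s ∈ I, A ×ˢ B ∩ {p | lineMap p.1 p.2 s ∈ M} := fun p hp => by
    obtain ⟨s, hs, hps⟩ := h p.1 hp.1 p.2 hp.2
    exact Set.mem_biUnion hs ⟨hp, hps⟩
  have hprod : max (μ A) (μ B) * min (μ A) (μ B) ≤
      max (μ A) (μ B) * (I.card * (2 ^ Module.finrank ℝ E * μ M)) :=
    calc max (μ A) (μ B) * min (μ A) (μ B) = (μ.prod μ) (A ×ˢ B) := by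
          rw [max_mul_min, Measure.prod_prod]
      _ ≤ ∑ s ∈ I, (μ.prod μ) (A ×ˢ B ∩ {p | lineMap p.1 p.2 s ∈ M}) :=
          (measure_mono hcover).trans (measure_biUnion_finset_le _ _)
      _ ≤ ∑ _s ∈ I, max (μ A) (μ B) * (2 ^ Module.finrank ℝ E * μ M) :=
          Finset.sum_le_sum fun s _ => prod_lineMap_mem_le μ hA hB hM s
      _ = max (μ A) (μ B) * (I.card * (2 ^ Module.finrank ℝ E * μ M)) := by
          rw [Finset.sum_const, nsmul_eq_mul, mul_left_comm]
  rcases eq_or_ne (max (μ A) (μ B)) 0 with hmax | hmax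
  · exact (min_le_max.trans_eq hmax).trans zero_le
  · exact (ENNReal.mul_le_mul_iff_right hmax (max_lt hA'.lt_top hB'.lt_top).ne).1 hprod

open AffineMap in
theorem min_measureReal_le_of_lineMap_mem {A B M : Set E} (hA : MeasurableSet A)
    (hB : MeasurableSet B) (hM : MeasurableSet M) (hA' : μ A ≠ ⊤) (hB' : μ B ≠ ⊤) (hM' : μ M ≠ ⊤)
    {I : Finset ℝ} (h : ∀ x ∈ A, ∀ y ∈ B, ∃ s ∈ I, lineMap x y s ∈ M) :
    min (μ.real A) (μ.real B) ≤ I.card * (2 ^ Module.finrank ℝ E * μ.real M) := by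
  have hle := ENNReal.toReal_mono (by finiteness)
    (min_measure_le_of_lineMap_mem μ hA hB hM hA' hB' h)
  rwa [ENNReal.toReal_min hA' hB', ENNReal.toReal_mul, ENNReal.toReal_mul, ENNReal.toReal_pow,
    ENNReal.toReal_natCast, ENNReal.toReal_ofNat] at hle

end Haar

/-- The number of labels in `S` whose point lies in `T`, as a real number. -/
noncomputable def labelCount {ι E : Type*} (X : ι → E) (S : Set ι) (T : Set E) : ℝ :=
  (S ∩ X ⁻¹' T).ncard

section LabelCount

variable {ι E : Type*} [Finite ι] {X : ι → E} {A B : Set ι} {T T' : Set E}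

theorem labelCount_le_labelCount (h : ∀ i ∈ A, X i ∈ T → i ∈ B ∧ X i ∈ T') :
    labelCount X A T ≤ labelCount X B T' :=
  Nat.cast_le.2 (Set.ncard_le_ncard fun i hi => h i hi.1 hi.2)

theorem labelCount_le_add_labelCount_sdiff (X : ι → E) (S : Set ι) (T T' : Set E) :
    labelCount X S T ≤ labelCount X S T' + labelCount X S (T \ T') := by
  refine le_trans (Nat.cast_le.2 (Set.ncard_le_ncard fun i hi => ?_))
    ((Nat.cast_le.2 (Set.ncard_union_le (S ∩ X ⁻¹' T') (S ∩ X ⁻¹' (T \ T')))).trans_eq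
      (Nat.cast_add _ _))
  by_cases hT' : X i ∈ T'
  · exact Or.inl ⟨hi.1, hT'⟩
  · exact Or.inr ⟨hi.1, hi.2, hT'⟩

theorem labelCount_union (hAB : Disjoint A B) (T : Set E) :
    labelCount X (A ∪ B) T = labelCount X A T + labelCount X B T := by
  rw [labelCount, Set.union_inter_distrib_right,
    Set.ncard_union_eq (hAB.mono Set.inter_subset_left Set.inter_subset_left), Nat.cast_add]
  rfl

theorem labelCount_le_ncard (X : ι → E) (S : Set ι) (T : Set E) :
    labelCount X S T ≤ S.ncard :=
  Nat.cast_le.2 (Set.ncard_le_ncard Set.inter_subset_left)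

theorem labelCount_univ_le (X : ι → E) (hAB : Disjoint A B) (T : Set E) :
    labelCount X Set.univ T ≤ labelCount X A T + labelCount X B T + ((A ∪ B)ᶜ).ncard := by
  rw [← Set.union_compl_self (A ∪ B), labelCount_union disjoint_compl_right,
    labelCount_union hAB]
  gcongr
  exact labelCount_le_ncard X _ T

end LabelCount

section Chernoff

variable {ι E : Type*} [Fintype ι]

theorem labelCount_univ_sub_eq_sum (X : ι → E) (T : Set E) (q : ℝ) :
    labelCount X Set.univ T - Fintype.card ι * q = ∑ i, (T.indicator 1 (X i) - q) := by
  classical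
  rw [labelCount, Set.univ_inter, Set.ncard_eq_toFinset_card', Finset.sum_sub_distrib,
    Finset.sum_const, Finset.card_univ, nsmul_eq_mul]
  simp [Set.indicator_apply]

theorem exp_mul_indicator_sub (T : Set E) (s q : ℝ) (x : E) :
    Real.exp (s * (T.indicator 1 x - q)) =
      Real.exp (-(s * q)) * (1 + T.indicator (fun _ => Real.exp s - 1) x) := by
  rw [mul_sub, sub_eq_neg_add, Real.exp_add]
  by_cases hx : x ∈ T <;> simp [hx]

variable [MeasurableSpace E] (μ : Measure E) [IsProbabilityMeasure μ]

theorem integral_exp_mul_indicator_sub_le {T : Set E} (hT : MeasurableSet T) {s : ℝ}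
    (hs : |s| ≤ 1) :
    ∫ x, Real.exp (s * (T.indicator 1 x - μ.real T)) ∂μ ≤ Real.exp (μ.real T * s ^ 2) := by
  calc ∫ x, Real.exp (s * (T.indicator 1 x - μ.real T)) ∂μ
      = Real.exp (-(s * μ.real T)) * (1 + μ.real T * (Real.exp s - 1)) := by
        simp_rw [exp_mul_indicator_sub]
        rw [integral_const_mul, integral_add (integrable_const 1)
          ((integrable_const _).indicator hT), integral_indicator_const _ hT]
        simp
    _ ≤ Real.exp (-(s * μ.real T)) * Real.exp (μ.real T * (Real.exp s - 1)) := by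
        gcongr
        linarith [Real.add_one_le_exp (μ.real T * (Real.exp s - 1))]
    _ = Real.exp (μ.real T * (Real.exp s - 1 - s)) := by rw [← Real.exp_add]; ring_nf
    _ ≤ Real.exp (μ.real T * s ^ 2) := by
        gcongr
        exact (le_abs_self _).trans (Real.abs_exp_sub_one_sub_id_le hs)

theorem measureReal_le_mul_labelCount_sub_le {T : Set E} (hT : MeasurableSet T) {p s : ℝ} (b : ℝ)
    (hTp : μ.real T ≤ p) (hs : |s| ≤ 1) :
    (Measure.pi fun _ : ι => μ).real
        {X | Fintype.card ι * b ≤ s * (labelCount X Set.univ T - Fintype.card ι * μ.real T)} ≤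
      Real.exp (Fintype.card ι * (p * s ^ 2 - b)) := by
  set f : E → ℝ := fun x => Real.exp (s * (T.indicator 1 x - μ.real T))
  set Y : (ι → E) → ℝ := fun X => s * (labelCount X Set.univ T - Fintype.card ι * μ.real T)
  have hf : Integrable f μ := by
    simp only [f, exp_mul_indicator_sub]
    exact ((integrable_const 1).add ((integrable_const _).indicator hT)).const_mul _
  have hY : (fun X : ι → E => Real.exp (1 * Y X)) = fun X => ∏ i, f (X i) := by
    funext X
    rw [one_mul, ← Real.exp_sum, ← Finset.mul_sum, ← labelCount_univ_sub_eq_sum]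
  have hmgf : ProbabilityTheory.mgf Y (Measure.pi fun _ : ι => μ) 1 ≤
      Real.exp (Fintype.card ι * (p * s ^ 2)) := by
    rw [ProbabilityTheory.mgf, hY, integral_fintype_prod_eq_pow, Real.exp_nat_mul]
    exact pow_le_pow_left₀ (integral_nonneg fun _ => (Real.exp_pos _).le)
      ((integral_exp_mul_indicator_sub_le μ hT hs).trans (by gcongr)) _
  calc (Measure.pi fun _ : ι => μ).real {X | Fintype.card ι * b ≤ Y X}
      ≤ Real.exp (-1 * (Fintype.card ι * b)) * ProbabilityTheory.mgf Y (Measure.pi fun _ => μ) 1 :=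
        ProbabilityTheory.measure_ge_le_exp_mul_mgf _ zero_le_one
          (hY ▸ Integrable.fintype_prod fun _ => hf)
    _ ≤ Real.exp (-1 * (Fintype.card ι * b)) * Real.exp (Fintype.card ι * (p * s ^ 2)) := by gcongr
    _ = Real.exp (Fintype.card ι * (p * s ^ 2 - b)) := by rw [← Real.exp_add]; ring_nf

theorem measureReal_lt_abs_labelCount_sub_le {T : Set E} (hT : MeasurableSet T) {p a : ℝ}
    (hp : 0 < p) (ha : 0 ≤ a) (hap : a ≤ 2 * p) (hTp : μ.real T ≤ p) :
    (Measure.pi fun _ : ι => μ).real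
        {X | Fintype.card ι * a < |labelCount X Set.univ T - Fintype.card ι * μ.real T|} ≤
      2 * Real.exp (-(Fintype.card ι * a ^ 2 / (4 * p))) := by
  set s := a / (2 * p)
  have hs0 : 0 ≤ s := by positivity
  have hs : |s| ≤ 1 := by rwa [abs_of_nonneg hs0, div_le_one (by positivity)]
  have hexponent : (Fintype.card ι : ℝ) * (p * s ^ 2 - s * a) =
      -(Fintype.card ι * a ^ 2 / (4 * p)) := by simp only [s]; field_simp; ring
  have hupper := measureReal_le_mul_labelCount_sub_le (ι := ι) μ hT (s * a) hTp hs
  have hlower := measureReal_le_mul_labelCount_sub_le (ι := ι) μ hT (s * a) hTp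
    ((abs_neg s).trans_le hs)
  rw [neg_sq, hexponent] at hlower
  rw [hexponent] at hupper
  rw [two_mul]
  refine (measureReal_mono fun X hX => ?_).trans ((measureReal_union_le _ _).trans
    (add_le_add hupper hlower))
  rcases lt_abs.1 (Set.mem_ofPred_eq ▸ hX) with h | h
  · exact Or.inl ((mul_left_comm _ _ _).trans_le (mul_le_mul_of_nonneg_left h.le hs0))
  · exact Or.inr ((mul_left_comm _ _ _).trans_le
      ((mul_le_mul_of_nonneg_left h.le hs0).trans_eq (by ring)))

theorem measureReal_exists_lt_abs_labelCount_sub_le {κ : Type*} (F : Finset κ) {T : κ → Set E}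
    (hT : ∀ k ∈ F, MeasurableSet (T k)) {p a : ℝ} (hp : 0 < p) (ha : 0 ≤ a) (hap : a ≤ 2 * p)
    (hTp : ∀ k ∈ F, μ.real (T k) ≤ p) :
    (Measure.pi fun _ : ι => μ).real {X | ∃ k ∈ F,
        Fintype.card ι * a < |labelCount X Set.univ (T k) - Fintype.card ι * μ.real (T k)|} ≤
      F.card * (2 * Real.exp (-(Fintype.card ι * a ^ 2 / (4 * p)))) := by
  let bad (k : κ) : Set (ι → E) :=
    {X | Fintype.card ι * a < |labelCount X Set.univ (T k) - Fintype.card ι * μ.real (T k)|}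
  calc (Measure.pi fun _ : ι => μ).real {X | ∃ k ∈ F, X ∈ bad k}
      ≤ (Measure.pi fun _ : ι => μ).real (⋃ k ∈ F, bad k) :=
        measureReal_mono (fun X ⟨k, hk, hX⟩ => Set.mem_biUnion hk hX) (measure_ne_top _ _)
    _ ≤ ∑ k ∈ F, (Measure.pi fun _ : ι => μ).real (bad k) := measureReal_biUnion_finset_le F bad
    _ ≤ ∑ _k ∈ F, 2 * Real.exp (-(Fintype.card ι * a ^ 2 / (4 * p))) :=
        Finset.sum_le_sum fun k hk =>
          measureReal_lt_abs_labelCount_sub_le μ (hT k hk) hp ha hap (hTp k hk)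
    _ = F.card * (2 * Real.exp (-(Fintype.card ι * a ^ 2 / (4 * p)))) := by
        rw [Finset.sum_const, nsmul_eq_mul]

end Chernoff

section Cells

variable {d : ℕ}

/-- The index of the cell containing `x` in the grid of mesh `1 / N`. -/
noncomputable def cellIndex (N : ℕ) (x : EuclideanSpace ℝ (Fin d)) : Fin d → ℤ :=
  fun i => ⌊N * x i⌋

/-- The part of the unit cube covered by the grid cells with index in `S`. -/
def cellUnion (N : ℕ) (S : Set (Fin d → ℤ)) : Set (EuclideanSpace ℝ (Fin d)) :=
  unitCube d ∩ cellIndex N ⁻¹' S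

/-- The part of the unit cube covered by the grid cells that meet `T` inside the cube. -/
def cellHull (N : ℕ) (T : Set (EuclideanSpace ℝ (Fin d))) : Set (EuclideanSpace ℝ (Fin d)) :=
  cellUnion N (cellIndex N '' (T ∩ unitCube d))

variable {N M : ℕ} {x y : EuclideanSpace ℝ (Fin d)} {T : Set (EuclideanSpace ℝ (Fin d))}

theorem measurable_cellIndex (d N : ℕ) :
    Measurable (cellIndex N : EuclideanSpace ℝ (Fin d) → Fin d → ℤ) :=
  measurable_pi_lambda _ fun i => Int.measurable_floor.comp (by fun_prop)

theorem measurableSet_cellUnion (N : ℕ) (S : Set (Fin d → ℤ)) : MeasurableSet (cellUnion N S) :=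
  (measurableSet_unitCube d).inter (measurable_cellIndex d N (Set.to_countable S).measurableSet)

theorem cellUnion_subset_unitCube (N : ℕ) (S : Set (Fin d → ℤ)) : cellUnion N S ⊆ unitCube d :=
  Set.inter_subset_left

theorem volume_cellUnion_ne_top (N : ℕ) (S : Set (Fin d → ℤ)) : volume (cellUnion N S) ≠ ⊤ :=
  measure_ne_top_of_subset (cellUnion_subset_unitCube N S) (by simp [volume_unitCube])

theorem uniformCube_real_cellUnion (N : ℕ) (S : Set (Fin d → ℤ)) :
    (uniformCube d).real (cellUnion N S) = volume.real (cellUnion N S) := by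
  rw [measureReal_def, uniformCube, Measure.restrict_apply (measurableSet_cellUnion N S),
    Set.inter_eq_self_of_subset_left (cellUnion_subset_unitCube N S), measureReal_def]

theorem inter_subset_cellHull (N : ℕ) (T : Set (EuclideanSpace ℝ (Fin d))) :
    T ∩ unitCube d ⊆ cellHull N T :=
  fun x hx => ⟨hx.2, x, hx, rfl⟩

theorem dist_le_of_cellIndex_eq (hN : 0 < N) (h : cellIndex N x = cellIndex N y) :
    dist x y ≤ √d / N := by
  have hN' : (0 : ℝ) < N := Nat.cast_pos.2 hN
  rw [div_eq_mul_inv]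
  refine dist_le_sqrt_mul_of_forall_abs_le (by positivity) fun i => ?_
  have hi : |N * x i - N * y i| < 1 := Int.abs_sub_lt_one_of_floor_eq_floor (congrFun h i)
  rw [← mul_sub, abs_mul, abs_of_pos hN'] at hi
  rw [← one_div, le_div_iff₀' hN']
  exact hi.le

theorem exists_dist_le_of_mem_cellHull (hN : 0 < N) (hy : y ∈ cellHull N T) :
    ∃ x ∈ T ∩ unitCube d, dist y x ≤ √d / N := by
  obtain ⟨-, x, hx, hxy⟩ := hy
  exact ⟨x, hx, dist_le_of_cellIndex_eq hN hxy.symm⟩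

theorem cellHull_subset_closedBall (hN : 0 < N) {s : ℝ} (hT : T ⊆ Metric.closedBall x s) :
    cellHull N T ⊆ Metric.closedBall x (s + √d / N) := fun y hy => by
  obtain ⟨z, hz, hyz⟩ := exists_dist_le_of_mem_cellHull hN hy
  have hzx : dist z x ≤ s := hT hz.1
  exact (dist_triangle y z x).trans (by linarith)

theorem volumeReal_cellHull_le [NeZero d] (hN : 0 < N) {s : ℝ} (hs : 0 ≤ s)
    (hT : T ⊆ Metric.closedBall x s) :
    volume.real (cellHull N T) ≤ 5 ^ d * cubeVolume d (s + √d / N) :=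
  (measureReal_mono (cellHull_subset_closedBall hN hT) measure_closedBall_lt_top.ne).trans
    (volumeReal_closedBall_le x (by positivity))

theorem cellIndex_mem_Icc_zero (hx : x ∈ unitCube d) :
    cellIndex N x ∈ Finset.Icc (0 : Fin d → ℤ) fun _ => (N : ℤ) := by
  refine Finset.mem_Icc.2 ⟨fun i => Int.floor_nonneg.2 (mul_nonneg N.cast_nonneg (hx i).1),
    fun i => Int.floor_le_iff.2 ?_⟩
  have : N * x i ≤ N := mul_le_of_le_one_right N.cast_nonneg (hx i).2
  push_cast
  linarith

theorem cellIndex_mem_Icc_of_dist_le {s : ℝ} (hxy : dist y x ≤ s) (hM : s * N + 1 ≤ M) :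
    cellIndex N y ∈
      Finset.Icc (cellIndex N x - fun _ => (M : ℤ)) (cellIndex N x + fun _ => (M : ℤ)) := by
  have hcoord (i : Fin d) : |N * y i - N * x i| ≤ s * N := by
    rw [← mul_sub, abs_mul, Nat.abs_cast, mul_comm]
    gcongr
    exact (PiLp.norm_apply_le (y - x) i).trans ((dist_eq_norm y x).symm.trans_le hxy)
  refine Finset.mem_Icc.2 ⟨fun i => Int.le_floor.2 ?_, fun i => Int.floor_le_iff.2 ?_⟩
  · have := Int.floor_le (N * x i)
    simp only [cellIndex, Pi.sub_apply]
    push_cast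
    linarith [(abs_le.1 (hcoord i)).1]
  · have := Int.lt_floor_add_one (N * x i)
    simp only [cellIndex, Pi.add_apply]
    push_cast
    linarith [(abs_le.1 (hcoord i)).2]

/-- The sets of cell indices contained in a cubical window of radius `M` centred at the index of a
cell of the unit cube. -/
noncomputable def cellWindows (d N M : ℕ) : Finset (Finset (Fin d → ℤ)) :=
  (Finset.Icc (0 : Fin d → ℤ) fun _ => (N : ℤ)).biUnion fun z =>
    (Finset.Icc (z - fun _ => (M : ℤ)) (z + fun _ => (M : ℤ))).powerset

theorem card_cellWindows_le (d N M : ℕ) :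
    (cellWindows d N M).card ≤ (N + 1) ^ d * 2 ^ (2 * M + 1) ^ d := by
  have hgrid : (Finset.Icc (0 : Fin d → ℤ) fun _ => (N : ℤ)).card = (N + 1) ^ d := by
    simp [Pi.card_Icc]
  have hwindow (z : Fin d → ℤ) :
      (Finset.Icc (z - fun _ => (M : ℤ)) (z + fun _ => (M : ℤ))).card = (2 * M + 1) ^ d := by
    have (i : Fin d) : (z i + M + 1 - (z i - M)).toNat = 2 * M + 1 := by omega
    simp [Pi.card_Icc, this]
  rw [← hgrid]
  exact Finset.card_biUnion_le_card_mul _ _ _ fun z _ => by rw [Finset.card_powerset, hwindow]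

theorem exists_mem_cellWindows_cellHull_eq (hx : x ∈ unitCube d) {s : ℝ}
    (hT : T ⊆ Metric.closedBall x s) (hM : s * N + 1 ≤ M) :
    ∃ S ∈ cellWindows d N M, cellHull N T = cellUnion N S := by
  have hsub : cellIndex N '' (T ∩ unitCube d) ⊆
      Finset.Icc (cellIndex N x - fun _ => (M : ℤ)) (cellIndex N x + fun _ => (M : ℤ)) := by
    rintro _ ⟨y, hy, rfl⟩
    exact cellIndex_mem_Icc_of_dist_le (hT hy.1) hM
  obtain ⟨S, hS⟩ := ((Finset.finite_toSet _).subset hsub).exists_finset_coe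
  refine ⟨S, Finset.mem_biUnion.2 ⟨cellIndex N x, cellIndex_mem_Icc_zero hx,
    Finset.mem_powerset.2 ?_⟩, by rw [hS, cellHull]⟩
  rwa [← Finset.coe_subset, hS]

end Cells

section EvenlySpread

variable {d n : ℕ}

/-- The number of points `X i` in any union of grid cells that meets the unit cube within a ball of
radius `2 * r` differs from its expectation by at most `n * a`. -/
def EvenlySpread (X : Fin n → EuclideanSpace ℝ (Fin d)) (N : ℕ) (r a : ℝ) : Prop :=
  ∀ x ∈ unitCube d, ∀ T ⊆ Metric.closedBall x (2 * r),
    |labelCount X Set.univ (cellHull N T) - n * volume.real (cellHull N T)| ≤ n * a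

theorem measureReal_not_evenlySpread_le [NeZero d] {N M : ℕ} (hN : 0 < N) {r a : ℝ} (hr : 0 < r)
    (hmesh : √d / N ≤ r) (hM : 2 * r * N + 1 ≤ M) (ha : 0 ≤ a)
    (ha' : a ≤ 2 * (15 ^ d * cubeVolume d r)) :
    (pointsLaw d n).real {X | ¬ EvenlySpread X N r a} ≤ (N + 1) ^ d * 2 ^ (2 * M + 1) ^ d *
      (2 * Real.exp (-(n * a ^ 2 / (4 * (15 ^ d * cubeVolume d r))))) := by
  classical
  have hp : 0 < 15 ^ d * cubeVolume d r := mul_pos (by positivity) (cubeVolume_pos d hr)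
  set F := (cellWindows d N M).filter fun S : Finset (Fin d → ℤ) =>
    (uniformCube d).real (cellUnion N S) ≤ 15 ^ d * cubeVolume d r
  have hsub : {X : Fin n → EuclideanSpace ℝ (Fin d) | ¬ EvenlySpread X N r a} ⊆
      {X | ∃ S ∈ F, Fintype.card (Fin n) * a < |labelCount X Set.univ (cellUnion N S) -
        Fintype.card (Fin n) * (uniformCube d).real (cellUnion N S)|} := fun X hX => by
    simp only [EvenlySpread, Set.mem_ofPred_eq] at hX
    push Not at hX
    obtain ⟨x, hx, T, hT, hlt⟩ := hX
    obtain ⟨S, hS, hTS⟩ := exists_mem_cellWindows_cellHull_eq hx hT hM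
    have hvol : volume.real (cellHull N T) ≤ 15 ^ d * cubeVolume d r :=
      calc volume.real (cellHull N T) ≤ 5 ^ d * cubeVolume d (2 * r + √d / N) :=
            volumeReal_cellHull_le hN (by positivity) hT
        _ ≤ 5 ^ d * cubeVolume d (3 * r) := by unfold cubeVolume; gcongr; linarith
        _ = 15 ^ d * cubeVolume d r := by rw [cubeVolume_mul, ← mul_assoc, ← mul_pow]; norm_num
    rw [hTS, ← uniformCube_real_cellUnion] at hlt hvol
    exact ⟨S, Finset.mem_filter.2 ⟨hS, hvol⟩, by rwa [Fintype.card_fin]⟩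
  have hunion := measureReal_exists_lt_abs_labelCount_sub_le (ι := Fin n) (uniformCube d) F
    (T := fun S => cellUnion N S) (fun _ _ => measurableSet_cellUnion _ _) hp ha ha'
    fun S hS => (Finset.mem_filter.1 hS).2
  have hcard : F.card ≤ (N + 1) ^ d * 2 ^ (2 * M + 1) ^ d :=
    (Finset.card_filter_le _ _).trans (card_cellWindows_le d N M)
  rw [Fintype.card_fin] at hunion hsub
  refine (measureReal_mono hsub (measure_ne_top _ _)).trans (hunion.trans ?_)
  gcongr
  exact_mod_cast hcard

end EvenlySpread

/-- The mesh of the grid, relative to the radius: so small that moving a ball of radius `r` by one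
mesh width changes its volume by at most a small multiple of `ε`. -/
noncomputable def meshRatio (d : ℕ) (ε : ℝ) : ℝ := ε / (64 * 20 ^ d)

/-- The admissible discrepancy of the proportion of points in a union of cells, relative to
`cubeVolume d r`. -/
noncomputable def discRatio (d : ℕ) (ε : ℝ) : ℝ := meshRatio d ε / (200 * 2 ^ d)

/-- The number of grid cells along a side of the unit cube. -/
noncomputable def gridSize (d : ℕ) (ε r : ℝ) : ℕ := ⌈√d / (meshRatio d ε * r)⌉₊

section Parameters

variable {d : ℕ} {ε r : ℝ}

theorem meshRatio_mul_pow (d : ℕ) (ε : ℝ) : meshRatio d ε * 20 ^ d = ε / 64 := by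
  unfold meshRatio
  field_simp

theorem meshRatio_pos (d : ℕ) (hε : 0 < ε) : 0 < meshRatio d ε := by
  unfold meshRatio
  positivity

theorem natCast_mul_meshRatio_le (d : ℕ) (hε : 0 ≤ ε) : d * meshRatio d ε ≤ ε / 64 := by
  have hd : (d : ℝ) ≤ 20 ^ d := mod_cast (Nat.lt_pow_self (by norm_num)).le
  have hρ : 0 ≤ meshRatio d ε := by unfold meshRatio; positivity
  calc d * meshRatio d ε ≤ 20 ^ d * meshRatio d ε := by gcongr
    _ = ε / 64 := by rw [mul_comm, meshRatio_mul_pow]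

theorem meshRatio_le (d : ℕ) (hε : 0 ≤ ε) : meshRatio d ε ≤ ε / 64 :=
  div_le_div_of_nonneg_left hε (by norm_num)
    (le_mul_of_one_le_right (by norm_num) (one_le_pow₀ (by norm_num)))

theorem discRatio_pos (d : ℕ) (hε : 0 < ε) : 0 < discRatio d ε :=
  div_pos (meshRatio_pos d hε) (by positivity)

theorem discRatio_le (d : ℕ) (hε : 0 < ε) : discRatio d ε ≤ ε / 100 :=
  calc discRatio d ε ≤ meshRatio d ε / 200 :=
        div_le_div_of_nonneg_left (meshRatio_pos d hε).le (by norm_num)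
          (le_mul_of_one_le_right (by norm_num) (one_le_pow₀ (by norm_num)))
    _ ≤ ε / 100 := by linarith [meshRatio_le d hε.le]

theorem gridSize_pos [NeZero d] (hε : 0 < ε) (hr : 0 < r) : 0 < gridSize d ε r := by
  have hd : 0 < d := NeZero.pos d
  have hρ := meshRatio_pos d hε
  exact Nat.ceil_pos.2 (by positivity)

theorem sqrt_div_gridSize_le [NeZero d] (hε : 0 < ε) (hr : 0 < r) :
    √d / gridSize d ε r ≤ meshRatio d ε * r := by
  have hN : (0 : ℝ) < gridSize d ε r := Nat.cast_pos.2 (gridSize_pos hε hr)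
  rw [div_le_comm₀ hN (mul_pos (meshRatio_pos d hε) hr)]
  exact Nat.le_ceil _

end Parameters

section Imbalance

variable {ι E : Type*} [PseudoMetricSpace E]

/-- The majority of `A` over `B` among the points within distance `r` of `x`. -/
noncomputable def imbalance (X : ι → E) (r : ℝ) (A B : Set ι) (x : E) : ℝ :=
  labelCount X A (Metric.closedBall x r) - labelCount X B (Metric.closedBall x r)

theorem imbalance_swap (X : ι → E) (r : ℝ) (A B : Set ι) (x : E) :
    imbalance X r B A x = -imbalance X r A B x := (neg_sub _ _).symm

variable [Finite ι] {x y : E} {δ : ℝ}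

theorem abs_labelCount_closedBall_sub_le (X : ι → E) (S : Set ι) (r : ℝ) (hxy : dist x y ≤ δ) :
    |labelCount X S (Metric.closedBall x r) - labelCount X S (Metric.closedBall y r)| ≤
      labelCount X S (Metric.closedBall x (r + δ) \ Metric.closedBall x (r - δ)) := by
  have hδ : 0 ≤ δ := dist_nonneg.trans hxy
  have hleft : labelCount X S (Metric.closedBall x r \ Metric.closedBall y r) ≤
      labelCount X S (Metric.closedBall x (r + δ) \ Metric.closedBall x (r - δ)) := by
    refine labelCount_le_labelCount fun i hi hz => ⟨hi, ?_⟩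
    simp only [Set.mem_sdiff, Metric.mem_closedBall, not_le] at hz ⊢
    constructor <;> linarith [dist_triangle (X i) x y]
  have hright : labelCount X S (Metric.closedBall y r \ Metric.closedBall x r) ≤
      labelCount X S (Metric.closedBall x (r + δ) \ Metric.closedBall x (r - δ)) := by
    refine labelCount_le_labelCount fun i hi hz => ⟨hi, ?_⟩
    simp only [Set.mem_sdiff, Metric.mem_closedBall, not_le] at hz ⊢
    constructor <;> linarith [dist_triangle_right (X i) x y]
  rw [abs_sub_le_iff]
  constructor <;> linarith [
    labelCount_le_add_labelCount_sdiff X S (Metric.closedBall x r) (Metric.closedBall y r),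
    labelCount_le_add_labelCount_sdiff X S (Metric.closedBall y r) (Metric.closedBall x r)]

theorem abs_imbalance_sub_le (X : ι → E) {A B : Set ι} (hAB : Disjoint A B) (r : ℝ)
    (hxy : dist x y ≤ δ) :
    |imbalance X r A B x - imbalance X r A B y| ≤
      labelCount X Set.univ (Metric.closedBall x (r + δ) \ Metric.closedBall x (r - δ)) := by
  set T := Metric.closedBall x (r + δ) \ Metric.closedBall x (r - δ)
  calc |imbalance X r A B x - imbalance X r A B y|
      ≤ labelCount X A T + labelCount X B T := by
        rw [imbalance, imbalance, sub_sub_sub_comm]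
        exact (abs_sub _ _).trans (add_le_add (abs_labelCount_closedBall_sub_le X A r hxy)
          (abs_labelCount_closedBall_sub_le X B r hxy))
    _ = labelCount X (A ∪ B) T := (labelCount_union hAB T).symm
    _ ≤ labelCount X Set.univ T := labelCount_le_labelCount fun _ _ hi => ⟨trivial, hi⟩

end Imbalance

theorem exists_abs_le_of_sign_change {f : ℕ → ℝ} {m : ℕ} {c : ℝ} (h0 : 0 < f 0) (hm : f m < 0)
    (h : ∀ i < m, |f i - f (i + 1)| ≤ c) : ∃ i ≤ m, |f i| ≤ c := by
  obtain ⟨i, him, hi, hi'⟩ : ∃ i < m, 0 < f i ∧ f (i + 1) ≤ 0 := by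
    by_contra! hpos
    have hall : ∀ i ≤ m, 0 < f i := fun i => by
      induction i with
      | zero => exact fun _ => h0
      | succ i ih => exact fun hi => hpos i hi (ih (by omega))
    exact (hall m le_rfl).not_gt hm
  refine ⟨i, him.le, (abs_of_pos hi).trans_le ?_⟩
  linarith [le_of_abs_le (h i him)]

/-- The points `0, 1 / m, …, 1`. -/
noncomputable def subdivision (m : ℕ) : Finset ℝ :=
  (Finset.range (m + 1)).image fun i : ℕ => (i : ℝ) / m

theorem card_subdivision_le (m : ℕ) : (subdivision m).card ≤ m + 1 :=
  Finset.card_image_le.trans_eq (Finset.card_range _)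

theorem card_subdivision_ceil_le (d : ℕ) {ε : ℝ} (hε : 0 < ε) (hε' : ε ≤ 1 / 2) :
    ((subdivision ⌈4 / meshRatio d ε⌉₊).card : ℝ) ≤ 5 / meshRatio d ε := by
  have hρ := meshRatio_pos d hε
  have htwo : 2 ≤ 1 / meshRatio d ε := by
    rw [le_div_iff₀ hρ]
    linarith [meshRatio_le d hε.le]
  calc ((subdivision ⌈4 / meshRatio d ε⌉₊).card : ℝ) ≤ ⌈4 / meshRatio d ε⌉₊ + 1 :=
        mod_cast card_subdivision_le _
    _ ≤ 4 / meshRatio d ε + 1 + 1 := by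
        gcongr
        exact (Nat.ceil_lt_add_one (by positivity)).le
    _ ≤ 4 / meshRatio d ε + 1 / meshRatio d ε := by linarith
    _ = 5 / meshRatio d ε := by ring

theorem mem_Icc_of_mem_subdivision {m : ℕ} {s : ℝ} (hs : s ∈ subdivision m) :
    s ∈ Set.Icc (0 : ℝ) 1 := by
  obtain ⟨i, hi, rfl⟩ := Finset.mem_image.1 hs
  exact ⟨by positivity, div_le_one_of_le₀ (mod_cast Finset.mem_range_succ_iff.1 hi) m.cast_nonneg⟩

open AffineMap in
theorem exists_mem_subdivision_abs_le {E : Type*} [NormedAddCommGroup E] [NormedSpace ℝ E]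
    {K : Set E} (hK : Convex ℝ K) {f : E → ℝ} {c δ : ℝ}
    (hf : ∀ x ∈ K, ∀ y, dist x y ≤ δ → |f x - f y| ≤ c) {x y : E} (hx : x ∈ K) (hy : y ∈ K)
    (hfx : 0 < f x) (hfy : f y < 0) {m : ℕ} (hm : 0 < m) (hxy : dist x y ≤ m * δ) :
    ∃ s ∈ subdivision m, |f (lineMap x y s)| ≤ c := by
  have hm' : (0 : ℝ) < m := Nat.cast_pos.2 hm
  have hmem {i : ℕ} (hi : i ≤ m) : (i : ℝ) / m ∈ subdivision m :=
    Finset.mem_image_of_mem _ (Finset.mem_range_succ_iff.2 hi)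
  obtain ⟨i, hi, hfi⟩ := exists_abs_le_of_sign_change (m := m) (c := c)
    (f := fun i => f (lineMap x y ((i : ℝ) / m))) (by simpa using hfx)
    (by simpa [div_self hm'.ne'] using hfy) fun i hi => by
      refine hf _ (hK.lineMap_mem hx hy (mem_Icc_of_mem_subdivision (hmem hi.le))) _ ?_
      rw [dist_lineMap_lineMap, Real.dist_eq, ← sub_div, Nat.cast_succ, sub_add_cancel_left,
        abs_div, abs_neg, abs_one, Nat.abs_cast, one_div, inv_mul_le_iff₀ hm']
      exact hxy
  exact ⟨_, hmem hi, hfi⟩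

section WellSpread

variable {d n : ℕ} {ε r : ℝ} {X : Fin n → EuclideanSpace ℝ (Fin d)}
  {x y : EuclideanSpace ℝ (Fin d)} {T : Set (EuclideanSpace ℝ (Fin d))} {A B : Set (Fin n)}

/-- A configuration of points of the unit cube whose counts are, at the scale `r`, close to their
expectations with the precision that the parameters `meshRatio`, `discRatio` demand. -/
structure WellSpread (ε r : ℝ) (X : Fin n → EuclideanSpace ℝ (Fin d)) : Prop where
  eps_pos : 0 < ε
  eps_le : ε ≤ 1 / 2
  radius_pos : 0 < r
  radius_le : r ≤ √d
  mem_cube : ∀ i, X i ∈ unitCube d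
  spread : EvenlySpread X (gridSize d ε r) r (discRatio d ε * cubeVolume d r)

namespace WellSpread

theorem labelCount_le_labelCount_cellHull (h : WellSpread ε r X) (S : Set (Fin n))
    (T : Set (EuclideanSpace ℝ (Fin d))) :
    labelCount X S T ≤ labelCount X Set.univ (cellHull (gridSize d ε r) T) :=
  labelCount_le_labelCount fun i _ hi => ⟨trivial, inter_subset_cellHull _ T ⟨hi, h.mem_cube i⟩⟩

variable [NeZero d]

theorem eps_mul_pos [NeZero n] (h : WellSpread ε r X) : 0 < ε * (n * cubeVolume d r) :=
  mul_pos h.eps_pos (mul_pos (Nat.cast_pos.2 (NeZero.pos n)) (cubeVolume_pos d h.radius_pos))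

theorem eps_mul_nonneg (h : WellSpread ε r X) : 0 ≤ ε * (n * cubeVolume d r) :=
  mul_nonneg h.eps_pos.le (mul_nonneg n.cast_nonneg (cubeVolume_pos d h.radius_pos).le)

theorem discRatio_mul_le (h : WellSpread ε r X) :
    n * (discRatio d ε * cubeVolume d r) ≤ ε / 100 * (n * cubeVolume d r) := by
  have hw : 0 ≤ cubeVolume d r := (cubeVolume_pos d h.radius_pos).le
  rw [mul_left_comm]
  gcongr
  exact discRatio_le d h.eps_pos

theorem eps_mul_le (h : WellSpread ε r X) :
    ε * (n * cubeVolume d r) ≤ 1 / 2 * (n * cubeVolume d r) :=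
  mul_le_mul_of_nonneg_right h.eps_le
    (mul_nonneg n.cast_nonneg (cubeVolume_pos d h.radius_pos).le)

theorem exists_dist_le_of_mem_cellHull (h : WellSpread ε r X)
    (hy : y ∈ cellHull (gridSize d ε r) T) :
    ∃ x ∈ T ∩ unitCube d, dist y x ≤ meshRatio d ε * r := by
  obtain ⟨x, hx, hyx⟩ := RGG.exists_dist_le_of_mem_cellHull (gridSize_pos h.eps_pos h.radius_pos) hy
  exact ⟨x, hx, hyx.trans (sqrt_div_gridSize_le h.eps_pos h.radius_pos)⟩

theorem half_le_labelCount_closedBall (h : WellSpread ε r X) (hx : x ∈ unitCube d) :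
    n * cubeVolume d r / 2 ≤ labelCount X Set.univ (Metric.closedBall x r) := by
  have hr := h.radius_pos
  have hρ := meshRatio_pos d h.eps_pos
  have hρ' := meshRatio_le d h.eps_pos.le
  have hε := h.eps_le
  set T := Metric.closedBall x ((1 - meshRatio d ε) * r)
  have hT : T ⊆ Metric.closedBall x (2 * r) :=
    Metric.closedBall_subset_closedBall (by gcongr; linarith)
  have hhull : cellHull (gridSize d ε r) T ⊆ Metric.closedBall x r := fun y hy => by
    obtain ⟨z, hz, hyz⟩ := h.exists_dist_le_of_mem_cellHull hy
    have hzx : dist z x ≤ (1 - meshRatio d ε) * r := hz.1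
    exact (dist_triangle y z x).trans (by linarith)
  have hvol : (1 - ε / 64) * cubeVolume d r ≤ volume.real (cellHull (gridSize d ε r) T) := by
    have hbernoulli : 1 - ε / 64 ≤ (1 - meshRatio d ε) ^ d := by
      have := one_add_mul_le_pow (a := -meshRatio d ε) (by linarith) d
      rw [← sub_eq_add_neg] at this
      linarith [natCast_mul_meshRatio_le d h.eps_pos.le]
    calc (1 - ε / 64) * cubeVolume d r ≤ cubeVolume d ((1 - meshRatio d ε) * r) := by
          rw [cubeVolume_mul]
          exact mul_le_mul_of_nonneg_right hbernoulli (cubeVolume_pos d hr).le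
      _ ≤ volume.real (T ∩ unitCube d) := cubeVolume_le_volumeReal_closedBall_inter_unitCube hx
          (mul_nonneg (by linarith) hr.le)
          ((mul_le_of_le_one_left hr.le (by linarith)).trans h.radius_le)
      _ ≤ _ := measureReal_mono (inter_subset_cellHull _ T) (volume_cellUnion_ne_top _ _)
  have hcount : labelCount X Set.univ (cellHull (gridSize d ε r) T) ≤
      labelCount X Set.univ (Metric.closedBall x r) :=
    labelCount_le_labelCount fun i hi hiT => ⟨hi, hhull hiT⟩
  linarith [(abs_le.1 (h.spread x hx T hT)).1, h.discRatio_mul_le, h.eps_mul_le,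
    h.eps_mul_nonneg, mul_le_mul_of_nonneg_left hvol n.cast_nonneg]

theorem volumeReal_cellHull_annulus_le (h : WellSpread ε r X) (x : EuclideanSpace ℝ (Fin d)) :
    volume.real (cellHull (gridSize d ε r) (Metric.closedBall x (r + meshRatio d ε * r) \
      Metric.closedBall x (r - meshRatio d ε * r))) ≤ ε / 16 * cubeVolume d r := by
  have hρ := meshRatio_pos d h.eps_pos
  have hρ' := meshRatio_le d h.eps_pos.le
  have hε := h.eps_le
  set ρ := meshRatio d ε with hρ_def
  have hsub : cellHull (gridSize d ε r)
        (Metric.closedBall x (r + ρ * r) \ Metric.closedBall x (r - ρ * r)) ⊆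
      Metric.closedBall x ((1 + 2 * ρ) * r) \ Metric.closedBall x ((1 - 2 * ρ) * r) := by
    intro y hy
    obtain ⟨z, ⟨hz, -⟩, hyz⟩ := h.exists_dist_le_of_mem_cellHull hy
    simp only [Set.mem_sdiff, Metric.mem_closedBall, not_le] at hz ⊢
    constructor <;> linarith [dist_triangle y z x, dist_triangle_left z x y]
  calc _ ≤ volume.real (Metric.closedBall x ((1 + 2 * ρ) * r) \
          Metric.closedBall x ((1 - 2 * ρ) * r)) := measureReal_mono hsub
        (measure_ne_top_of_subset Set.sdiff_subset measure_closedBall_lt_top.ne)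
    _ ≤ 2 * (2 * ρ) * 4 ^ d * volume.real (Metric.closedBall x r) := by
        simpa using measureReal_closedBall_sdiff_closedBall_le volume x h.radius_pos.le
          (t := 2 * ρ) (by linarith) (by linarith)
    _ ≤ 2 * (2 * ρ) * 4 ^ d * (5 ^ d * cubeVolume d r) := by
        gcongr
        exact volumeReal_closedBall_le x h.radius_pos.le
    _ = 4 * (ρ * 20 ^ d) * cubeVolume d r := by
        rw [show (20 : ℝ) = 4 * 5 by norm_num, mul_pow]
        ring
    _ = ε / 16 * cubeVolume d r := by rw [hρ_def, meshRatio_mul_pow]; ring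

theorem labelCount_annulus_le (h : WellSpread ε r X) (hx : x ∈ unitCube d) :
    labelCount X Set.univ (Metric.closedBall x (r + meshRatio d ε * r) \
      Metric.closedBall x (r - meshRatio d ε * r)) ≤ ε / 8 * (n * cubeVolume d r) := by
  set T := Metric.closedBall x (r + meshRatio d ε * r) \
    Metric.closedBall x (r - meshRatio d ε * r)
  have hT : T ⊆ Metric.closedBall x (2 * r) := by
    refine Set.sdiff_subset.trans (Metric.closedBall_subset_closedBall ?_)
    nlinarith [h.radius_pos, h.eps_le, meshRatio_le d h.eps_pos.le]
  have hvol := mul_le_mul_of_nonneg_left (h.volumeReal_cellHull_annulus_le x) n.cast_nonneg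
  linarith [h.labelCount_le_labelCount_cellHull Set.univ T, (abs_le.1 (h.spread x hx T hT)).2,
    h.discRatio_mul_le, h.eps_mul_nonneg]

theorem abs_imbalance_sub_le (h : WellSpread ε r X) (hAB : Disjoint A B) (hx : x ∈ unitCube d)
    (hxy : dist x y ≤ meshRatio d ε * r) :
    |imbalance X r A B x - imbalance X r A B y| ≤ ε / 8 * (n * cubeVolume d r) :=
  (RGG.abs_imbalance_sub_le X hAB r hxy).trans (h.labelCount_annulus_le hx)

end WellSpread

/-- The balanced places: those where `A` and `B` have almost equal numbers of points in the ball of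
radius `r`. -/
def balancedSet (ε r : ℝ) (X : Fin n → EuclideanSpace ℝ (Fin d)) (A B : Set (Fin n)) :
    Set (EuclideanSpace ℝ (Fin d)) :=
  {x | |imbalance X r A B x| ≤ ε / 8 * (n * cubeVolume d r)}

theorem balancedSet_swap (ε r : ℝ) (X : Fin n → EuclideanSpace ℝ (Fin d)) (A B : Set (Fin n)) :
    balancedSet ε r X B A = balancedSet ε r X A B := by
  unfold balancedSet
  simp_rw [imbalance_swap X r A B, abs_neg]

/-- Disjoint sets of labels that together miss few labels, such that within distance `r` of each
point of either set that set has a clear majority over the other. -/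
structure IsMajoritySplit (ε r : ℝ) (X : Fin n → EuclideanSpace ℝ (Fin d)) (A B : Set (Fin n)) :
    Prop where
  disjoint : Disjoint A B
  card_compl_le : ((A ∪ B)ᶜ.ncard : ℝ) ≤ n * (discRatio d ε * cubeVolume d r)
  majority_left : ∀ u ∈ A, 2 * ε * labelCount X Set.univ (Metric.closedBall (X u) r) -
    2 * (A ∪ B)ᶜ.ncard ≤ imbalance X r A B (X u)
  majority_right : ∀ u ∈ B, 2 * ε * labelCount X Set.univ (Metric.closedBall (X u) r) -
    2 * (A ∪ B)ᶜ.ncard ≤ imbalance X r B A (X u)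

namespace IsMajoritySplit

theorem symm (h : IsMajoritySplit ε r X A B) : IsMajoritySplit ε r X B A where
  disjoint := h.disjoint.symm
  card_compl_le := by rw [Set.union_comm]; exact h.card_compl_le
  majority_left := by rw [Set.union_comm]; exact h.majority_right
  majority_right := by rw [Set.union_comm]; exact h.majority_left

variable [NeZero d]

theorem le_imbalance (h : IsMajoritySplit ε r X A B) (hX : WellSpread ε r X) {u : Fin n}
    (hu : u ∈ A) : 3 / 4 * ε * (n * cubeVolume d r) ≤ imbalance X r A B (X u) := by
  linarith [h.majority_left u hu, h.card_compl_le, hX.discRatio_mul_le, hX.eps_mul_nonneg,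
    mul_le_mul_of_nonneg_left (hX.half_le_labelCount_closedBall (hX.mem_cube u)) hX.eps_pos.le]

theorem half_le_imbalance_of_dist_le (h : IsMajoritySplit ε r X A B) (hX : WellSpread ε r X)
    {u : Fin n} (hu : u ∈ A) (hx : dist (X u) x ≤ meshRatio d ε * r) :
    ε / 2 * (n * cubeVolume d r) ≤ imbalance X r A B x := by
  linarith [h.le_imbalance hX hu, hX.eps_mul_nonneg,
    le_of_abs_le (hX.abs_imbalance_sub_le h.disjoint (hX.mem_cube u) hx)]

theorem volumeReal_cellHull_balancedSet_le [NeZero n] (h : IsMajoritySplit ε r X A B)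
    (hX : WellSpread ε r X) (hx : x ∈ unitCube d) :
    volume.real (cellHull (gridSize d ε r) (balancedSet ε r X A B ∩ Metric.closedBall x (2 * r))) ≤
      2 * (discRatio d ε * cubeVolume d r) := by
  have hn : (0 : ℝ) < n := Nat.cast_pos.2 (NeZero.pos n)
  have hε := hX.eps_mul_pos
  set T := balancedSet ε r X A B ∩ Metric.closedBall x (2 * r)
  have hcount : labelCount X Set.univ (cellHull (gridSize d ε r) T) ≤ (A ∪ B)ᶜ.ncard := by
    refine (labelCount_le_labelCount (T' := Set.univ) (B := (A ∪ B)ᶜ) fun i _ hi =>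
      ⟨?_, trivial⟩).trans (labelCount_le_ncard X _ _)
    obtain ⟨z, ⟨⟨hz, -⟩, -⟩, hiz⟩ := hX.exists_dist_le_of_mem_cellHull hi
    obtain ⟨hlower, hupper⟩ := abs_le.1 (show |imbalance X r A B z| ≤ _ from hz)
    rintro (hiA | hiB)
    · linarith [h.half_le_imbalance_of_dist_le hX hiA hiz]
    · linarith [h.symm.half_le_imbalance_of_dist_le hX hiB hiz, imbalance_swap X r A B z]
  refine le_of_mul_le_mul_left ?_ hn
  linarith [(abs_le.1 (hX.spread x hx T Set.inter_subset_right)).1, h.card_compl_le]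

theorem le_volumeReal_cellHull_image [NeZero n] (h : IsMajoritySplit ε r X A B)
    (hX : WellSpread ε r X) (hx : x ∈ unitCube d) (hbal : x ∈ balancedSet ε r X A B) :
    cubeVolume d r / 16 ≤
      volume.real (cellHull (gridSize d ε r) (X '' A ∩ Metric.closedBall x r)) := by
  have hn : (0 : ℝ) < n := Nat.cast_pos.2 (NeZero.pos n)
  have hT : X '' A ∩ Metric.closedBall x r ⊆ Metric.closedBall x (2 * r) :=
    Set.inter_subset_right.trans
      (Metric.closedBall_subset_closedBall (by linarith [hX.radius_pos]))
  have hA : labelCount X A (Metric.closedBall x r) ≤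
      labelCount X A (X '' A ∩ Metric.closedBall x r) :=
    labelCount_le_labelCount fun i hi hix => ⟨hi, Set.mem_image_of_mem X hi, hix⟩
  have hdiff : -(ε / 8 * (n * cubeVolume d r)) ≤ labelCount X A (Metric.closedBall x r) -
      labelCount X B (Metric.closedBall x r) := (abs_le.1 hbal).1
  refine le_of_mul_le_mul_left ?_ hn
  linarith [labelCount_univ_le X h.disjoint (Metric.closedBall x r), h.card_compl_le,
    hX.half_le_labelCount_closedBall hx,
    hX.labelCount_le_labelCount_cellHull A (X '' A ∩ Metric.closedBall x r),
    (abs_le.1 (hX.spread x hx _ hT)).2, hX.discRatio_mul_le, hX.eps_mul_le]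

theorem exists_mem_subdivision_mem_balancedSet (h : IsMajoritySplit ε r X A B)
    (hX : WellSpread ε r X) (hx : x ∈ unitCube d) (hy : y ∈ unitCube d)
    (hxA : 0 < imbalance X r A B x) (hyB : 0 < imbalance X r B A y) {m : ℕ} (hm : 0 < m)
    (hxy : dist x y ≤ m * (meshRatio d ε * r)) :
    ∃ s ∈ subdivision m, AffineMap.lineMap x y s ∈ balancedSet ε r X A B :=
  exists_mem_subdivision_abs_le (convex_unitCube d)
    (fun _ hz _ hzw => hX.abs_imbalance_sub_le h.disjoint hz hzw) hx hy hxA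
    (by rwa [imbalance_swap, neg_pos] at hyB) hm hxy

variable [NeZero n]

theorem exists_mem_balancedSet (h : IsMajoritySplit ε r X A B) (hX : WellSpread ε r X)
    (hA : A.Nonempty) (hB : B.Nonempty) : ∃ x ∈ unitCube d, x ∈ balancedSet ε r X A B := by
  obtain ⟨u, hu⟩ := hA
  obtain ⟨v, hv⟩ := hB
  have hstep : 0 < meshRatio d ε * r := mul_pos (meshRatio_pos d hX.eps_pos) hX.radius_pos
  have hε := hX.eps_mul_pos
  obtain ⟨m, hm⟩ := exists_nat_gt (dist (X u) (X v) / (meshRatio d ε * r))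
  have hm0 : 0 < m := Nat.cast_pos.1 ((div_nonneg dist_nonneg hstep.le).trans_lt hm)
  obtain ⟨s, hs, hbal⟩ := h.exists_mem_subdivision_mem_balancedSet hX (hX.mem_cube u)
    (hX.mem_cube v) (by linarith [h.le_imbalance hX hu])
    (by linarith [h.symm.le_imbalance hX hv]) hm0 ((div_lt_iff₀ hstep).1 hm).le
  exact ⟨_, (convex_unitCube d).lineMap_mem (hX.mem_cube u) (hX.mem_cube v)
    (mem_Icc_of_mem_subdivision hs), hbal⟩

theorem imbalance_pos_of_mem_cellHull (h : IsMajoritySplit ε r X A B) (hX : WellSpread ε r X)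
    (hy : y ∈ cellHull (gridSize d ε r) (X '' A ∩ T)) : 0 < imbalance X r A B y := by
  obtain ⟨_, ⟨⟨⟨u, hu, rfl⟩, -⟩, -⟩, hyu⟩ := hX.exists_dist_le_of_mem_cellHull hy
  rw [dist_comm] at hyu
  linarith [h.half_le_imbalance_of_dist_le hX hu hyu, hX.eps_mul_pos]

theorem exists_lineMap_mem_cellHull_balancedSet (h : IsMajoritySplit ε r X A B)
    (hX : WellSpread ε r X) {x₀ : EuclideanSpace ℝ (Fin d)} {m : ℕ} (hm : 4 / meshRatio d ε ≤ m)
    (hx : x ∈ cellHull (gridSize d ε r) (X '' A ∩ Metric.closedBall x₀ r))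
    (hy : y ∈ cellHull (gridSize d ε r) (X '' B ∩ Metric.closedBall x₀ r)) :
    ∃ s ∈ subdivision m, AffineMap.lineMap x y s ∈
      cellHull (gridSize d ε r) (balancedSet ε r X A B ∩ Metric.closedBall x₀ (2 * r)) := by
  have hr := hX.radius_pos
  have hρ := meshRatio_pos d hX.eps_pos
  have hxcube : x ∈ unitCube d := cellUnion_subset_unitCube _ _ hx
  have hycube : y ∈ unitCube d := cellUnion_subset_unitCube _ _ hy
  have hball {S : Set (Fin n)} :
      cellHull (gridSize d ε r) (X '' S ∩ Metric.closedBall x₀ r) ⊆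
        Metric.closedBall x₀ (2 * r) := fun z hz => by
    obtain ⟨w, ⟨⟨-, hw : dist w x₀ ≤ r⟩, -⟩, hzw⟩ := hX.exists_dist_le_of_mem_cellHull hz
    have hρ' : meshRatio d ε ≤ 1 := by linarith [meshRatio_le d hX.eps_pos.le, hX.eps_le]
    exact (dist_triangle z w x₀).trans (by linarith [mul_le_of_le_one_left hr.le hρ'])
  have hdist : dist x y ≤ m * (meshRatio d ε * r) :=
    calc dist x y ≤ 2 * r + 2 * r :=
          (dist_triangle_right x y x₀).trans (add_le_add (hball hx) (hball hy))
      _ = 4 * r := by ring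
      _ ≤ m * meshRatio d ε * r := by gcongr; exact (div_le_iff₀ hρ).1 hm
      _ = m * (meshRatio d ε * r) := mul_assoc _ _ _
  have hm0 : 0 < m := Nat.cast_pos.1 ((by positivity : (0 : ℝ) < 4 / meshRatio d ε).trans_le hm)
  obtain ⟨s, hs, hbal⟩ := h.exists_mem_subdivision_mem_balancedSet hX hxcube hycube
    (h.imbalance_pos_of_mem_cellHull hX hx) (h.symm.imbalance_pos_of_mem_cellHull hX hy) hm0 hdist
  have hs01 := mem_Icc_of_mem_subdivision hs
  exact ⟨s, hs, inter_subset_cellHull _ _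
    ⟨⟨hbal, (convex_closedBall x₀ (2 * r)).lineMap_mem (hball hx) (hball hy) hs01⟩,
      (convex_unitCube d).lineMap_mem hxcube hycube hs01⟩⟩

theorem eq_empty_or_eq_empty (h : IsMajoritySplit ε r X A B) (hX : WellSpread ε r X) :
    A = ∅ ∨ B = ∅ := by
  by_contra! hne
  have hρ := meshRatio_pos d hX.eps_pos
  have hw : 0 < cubeVolume d r := cubeVolume_pos d hX.radius_pos
  obtain ⟨x₀, hx₀, hbal⟩ := h.exists_mem_balancedSet hX hne.1 hne.2
  have hmeet := min_measureReal_le_of_lineMap_mem volume (measurableSet_cellUnion _ _)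
    (measurableSet_cellUnion _ _) (measurableSet_cellUnion _ _) (volume_cellUnion_ne_top _ _)
    (volume_cellUnion_ne_top _ _) (volume_cellUnion_ne_top _ _) fun x hx y hy =>
      h.exists_lineMap_mem_cellHull_balancedSet hX (x₀ := x₀) (Nat.le_ceil _) hx hy
  rw [finrank_euclideanSpace_fin] at hmeet
  have hmin : cubeVolume d r / 16 ≤ cubeVolume d r / 20 :=
    calc cubeVolume d r / 16 ≤ _ := le_min (h.le_volumeReal_cellHull_image hX hx₀ hbal)
          (h.symm.le_volumeReal_cellHull_image hX hx₀ (by rwa [balancedSet_swap]))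
      _ ≤ _ := hmeet
      _ ≤ 5 / meshRatio d ε * (2 ^ d * (2 * (discRatio d ε * cubeVolume d r))) := by
          gcongr
          · exact card_subdivision_ceil_le d hX.eps_pos hX.eps_le
          · exact h.volumeReal_cellHull_balancedSet_le hX hx₀
      _ = cubeVolume d r / 20 := by unfold discRatio; field_simp; norm_num
  linarith

end IsMajoritySplit

end WellSpread

section Graphs

theorem exists_cut_of_not_connected {V : Type*} [Nonempty V] {G : SimpleGraph V}
    (h : ¬ G.Connected) :
    ∃ S : Set V, S.Nonempty ∧ Sᶜ.Nonempty ∧ ∀ a ∈ S, ∀ b ∈ Sᶜ, ¬ G.Adj a b := by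
  obtain ⟨a, b, hab⟩ : ∃ a b, ¬ G.Reachable a b := by
    by_contra! hreach
    exact h ⟨hreach⟩
  exact ⟨{v | G.Reachable a v}, ⟨a, .refl a⟩, ⟨b, hab⟩,
    fun _ hv _ hw hadj => hw (.trans hv hadj.reachable)⟩

theorem exists_cut_of_not_connected_induce {V : Type*} {H : SimpleGraph V} {W : Set V}
    (hW : W.Nonempty) (h : ¬ (H.induce W).Connected) :
    ∃ A B : Set V, A.Nonempty ∧ B.Nonempty ∧ Disjoint A B ∧ A ∪ B = W ∧
      ∀ a ∈ A, ∀ b ∈ B, ¬ H.Adj a b := by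
  have : Nonempty W := hW.to_subtype
  obtain ⟨S, hS, hS', hcut⟩ := exists_cut_of_not_connected h
  refine ⟨(↑) '' S, (↑) '' Sᶜ, hS.image _, hS'.image _,
    (Set.disjoint_image_iff Subtype.val_injective).2 disjoint_compl_right, ?_, ?_⟩
  · rw [← Set.image_union, Set.union_compl_self, Set.image_univ, Subtype.range_coe]
  · rintro _ ⟨a, ha, rfl⟩ _ ⟨b, hb, rfl⟩ hadj
    exact hcut a ha b hb hadj

variable {d n : ℕ} {ε r : ℝ} {X : Fin n → EuclideanSpace ℝ (Fin d)} {H : SimpleGraph (Fin n)}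
  {A B : Set (Fin n)}

theorem labelCount_closedBall_le_ncard_neighborSet_add_one (X : Fin n → EuclideanSpace ℝ (Fin d))
    (r : ℝ) (u : Fin n) :
    labelCount X Set.univ (Metric.closedBall (X u) r) ≤
      ((geomGraph X r).neighborSet u).ncard + 1 := by
  have hsub : Set.univ ∩ X ⁻¹' Metric.closedBall (X u) r ⊆
      insert u ((geomGraph X r).neighborSet u) := fun i hi => by
    by_cases hiu : i = u
    · exact .inl hiu
    · exact .inr ⟨Ne.symm hiu, (dist_comm _ _).trans_le hi.2⟩
  rw [labelCount]
  exact_mod_cast (Set.ncard_le_ncard hsub).trans (Set.ncard_insert_le u _)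

theorem ncard_neighborSet_add_one_le (hr : 0 ≤ r) (hH : H ≤ geomGraph X r) {u : Fin n}
    (hu : u ∈ A) (hcut : ∀ b ∈ B, ¬ H.Adj u b) :
    (H.neighborSet u).ncard + 1 ≤
      labelCount X A (Metric.closedBall (X u) r) + (A ∪ B)ᶜ.ncard := by
  have hsub : insert u (H.neighborSet u) ⊆
      A ∩ X ⁻¹' Metric.closedBall (X u) r ∪ (A ∪ B)ᶜ := by
    refine Set.insert_subset (.inl ⟨hu, Metric.mem_closedBall_self hr⟩) fun i hi => ?_
    by_cases hiA : i ∈ A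
    · exact .inl ⟨hiA, (dist_comm _ _).trans_le (hH hi).2⟩
    · exact .inr (not_or.2 ⟨hiA, fun hiB => hcut i hiB hi⟩)
  have hcard := (Set.ncard_le_ncard hsub).trans (Set.ncard_union_le _ _)
  rw [Set.ncard_insert_of_notMem H.notMem_neighborSet_self] at hcard
  rw [labelCount]
  exact_mod_cast hcard

theorem le_imbalance_of_isAlphaSubgraph (hε : 0 ≤ ε) (hε' : ε ≤ 1 / 2) (hr : 0 ≤ r)
    (hH : IsAlphaSubgraph (1 / 2 + ε) H (geomGraph X r)) (hAB : Disjoint A B) {u : Fin n}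
    (hu : u ∈ A) (hcut : ∀ b ∈ B, ¬ H.Adj u b) :
    2 * ε * labelCount X Set.univ (Metric.closedBall (X u) r) - 2 * (A ∪ B)ᶜ.ncard ≤
      imbalance X r A B (X u) := by
  have htotal : labelCount X A (Metric.closedBall (X u) r) +
      labelCount X B (Metric.closedBall (X u) r) ≤
        labelCount X Set.univ (Metric.closedBall (X u) r) := by
    rw [← labelCount_union hAB]
    exact labelCount_le_labelCount fun _ _ hi => ⟨trivial, hi⟩
  have hdeg := mul_le_mul_of_nonneg_left
    (labelCount_closedBall_le_ncard_neighborSet_add_one X r u) (by linarith : 0 ≤ 1 / 2 + ε)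
  rw [imbalance]
  linarith [hH.2 u, ncard_neighborSet_add_one_le hr hH.1 hu hcut]

/-- The constant `c₁` in the connectivity `c₁ r ^ d n` of the subgraphs. -/
noncomputable def connRatio (d : ℕ) (ε : ℝ) : ℝ := discRatio d ε / √d ^ d

theorem connRatio_pos [NeZero d] (hε : 0 < ε) : 0 < connRatio d ε :=
  div_pos (discRatio_pos d hε) (pow_pos (Real.sqrt_pos.2 (Nat.cast_pos.2 (NeZero.pos d))) d)

theorem connRatio_mul_pow_mul (d n : ℕ) (ε r : ℝ) :
    connRatio d ε * r ^ d * n = n * (discRatio d ε * cubeVolume d r) := by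
  rw [connRatio, cubeVolume, div_pow]
  ring

namespace WellSpread

variable [NeZero d]

theorem ceil_connRatio_lt (hX : WellSpread ε r X) (hn : 2 ≤ n) :
    ⌈connRatio d ε * r ^ d * n⌉₊ < n := by
  have hn' : (2 : ℝ) ≤ n := mod_cast hn
  have hw := cubeVolume_pos d hX.radius_pos
  have hγ := discRatio_pos d hX.eps_pos
  have hw1 : cubeVolume d r ≤ 1 :=
    pow_le_one₀ (by have := hX.radius_pos; positivity)
      (div_le_one_of_le₀ hX.radius_le (Real.sqrt_nonneg _))
  have hle : n * (discRatio d ε * cubeVolume d r) ≤ n / 2 :=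
    calc n * (discRatio d ε * cubeVolume d r) ≤ n * (1 / 2 * 1) := by
          gcongr
          linarith [discRatio_le d hX.eps_pos, hX.eps_le, hX.eps_pos]
      _ = n / 2 := by ring
  rw [connRatio_mul_pow_mul, ← Nat.cast_lt (α := ℝ)]
  linarith [Nat.ceil_lt_add_one (mul_nonneg (Nat.cast_nonneg n) (mul_nonneg hγ.le hw.le))]

theorem isKConnected (hX : WellSpread ε r X) (hn : 2 ≤ n)
    (hH : IsAlphaSubgraph (1 / 2 + ε) H (geomGraph X r)) :
    IsKConnected H ⌈connRatio d ε * r ^ d * n⌉₊ := by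
  have : NeZero n := ⟨by omega⟩
  have hk := hX.ceil_connRatio_lt hn
  refine ⟨by rwa [Fintype.card_fin], fun U hU => ?_⟩
  have hne : ((U : Set (Fin n))ᶜ).Nonempty := by
    rw [Set.nonempty_compl, Ne, Finset.coe_eq_univ, ← Finset.card_eq_iff_eq_univ, Fintype.card_fin]
    omega
  by_contra hcon
  obtain ⟨A, B, hA, hB, hAB, hunion, hcut⟩ := exists_cut_of_not_connected_induce hne hcon
  have hsplit : IsMajoritySplit ε r X A B :=
    { disjoint := hAB
      card_compl_le := by
        rw [hunion, compl_compl, Set.ncard_coe_finset, ← connRatio_mul_pow_mul]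
        exact (Nat.lt_ceil.1 hU).le
      majority_left := fun u hu => le_imbalance_of_isAlphaSubgraph hX.eps_pos.le hX.eps_le
        hX.radius_pos.le hH hAB hu (hcut u hu)
      majority_right := fun u hu => by
        rw [Set.union_comm]
        exact le_imbalance_of_isAlphaSubgraph hX.eps_pos.le hX.eps_le hX.radius_pos.le hH
          hAB.symm hu fun a ha hadj => hcut a ha u hu hadj.symm }
  rcases hsplit.eq_empty_or_eq_empty hX with rfl | rfl
  · exact Set.not_nonempty_empty hA
  · exact Set.not_nonempty_empty hB

end WellSpread

theorem IsKConnected.connected {V : Type*} [Fintype V] {G : SimpleGraph V} {k : ℕ}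
    (h : IsKConnected G k) (hk : 0 < k) : G.Connected := by
  have hG := h.2 ∅ hk
  rw [Finset.coe_empty, Set.compl_empty] at hG
  exact G.induceUnivIso.connected_iff.1 hG

theorem geomGraph_min_sqrt (hX : ∀ i, X i ∈ unitCube d) (r : ℝ) :
    geomGraph X (min r √d) = geomGraph X r := by
  ext i j
  simp only [geomGraph, le_min_iff, dist_le_sqrt_of_mem_unitCube (hX i) (hX j), and_true]

end Graphs

section Parameters

variable {d n : ℕ} {ε r : ℝ}

/-- The number of grid cells needed to cross a ball of radius `2 * r` from its centre. -/
noncomputable def windowSize (d : ℕ) (ε : ℝ) : ℕ := ⌈2 * √d / meshRatio d ε + 2 * √d + 1⌉₊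

/-- The absolute constant `K` of the radius bound, chosen so that the Chernoff exponent is at least
`2 * log n`: here `12800 = 64 * 200` and `24000 = 15 * (20 * 2) ^ 2` come from `discRatio` and from
the volume bound `15 ^ d * cubeVolume d r` for a union of cells. -/
noncomputable def radiusConst : ℝ := 8 * 12800 ^ 2 * 24000

/-- The constant `C₁ = K ε ^ (-2 / d) √d` of the radius bound. -/
noncomputable def radiusCoeff (d : ℕ) (ε : ℝ) : ℝ := radiusConst * ε ^ (-2 / (d : ℝ)) * √d

theorem gridSize_lt_add_one (hε : 0 < ε) (hr : 0 < r) :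
    gridSize d ε r < √d / (meshRatio d ε * r) + 1 :=
  Nat.ceil_lt_add_one (by have := meshRatio_pos d hε; positivity)

theorem two_mul_mul_gridSize_add_one_le_windowSize (hε : 0 < ε) (hr : 0 < r) (hr' : r ≤ √d) :
    2 * r * gridSize d ε r + 1 ≤ windowSize d ε := by
  have hρ := meshRatio_pos d hε
  calc 2 * r * gridSize d ε r + 1 ≤ 2 * r * (√d / (meshRatio d ε * r) + 1) + 1 := by
        gcongr; exact (gridSize_lt_add_one hε hr).le
    _ = 2 * √d / meshRatio d ε + 2 * r + 1 := by field_simp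
    _ ≤ 2 * √d / meshRatio d ε + 2 * √d + 1 := by gcongr
    _ ≤ windowSize d ε := Nat.le_ceil _

theorem gridSize_add_one_pow_mul_cubeVolume_le [NeZero d] (hε : 0 < ε) (hr : 0 < r)
    (hr' : r ≤ √d) :
    (gridSize d ε r + 1) ^ d * cubeVolume d r ≤ (1 / meshRatio d ε + 2) ^ d := by
  have hd : 0 < √(d : ℝ) := Real.sqrt_pos.2 (Nat.cast_pos.2 (NeZero.pos d))
  have hρ := meshRatio_pos d hε
  rw [cubeVolume, ← mul_pow]
  gcongr
  calc (gridSize d ε r + 1) * (r / √d) ≤ (√d / (meshRatio d ε * r) + 1 + 1) * (r / √d) := by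
        gcongr; exact (gridSize_lt_add_one hε hr).le
    _ = 1 / meshRatio d ε + 2 * (r / √d) := by field_simp; ring
    _ ≤ 1 / meshRatio d ε + 2 := by linarith [div_le_one_of_le₀ hr' hd.le]

theorem radiusConst_pos : 0 < radiusConst := by
  unfold radiusConst
  norm_num

theorem le_radiusConst_pow [NeZero d] : 8 * 12800 ^ 2 * 24000 ^ d ≤ radiusConst ^ d := by
  rw [radiusConst, mul_pow]
  gcongr
  exact le_self_pow₀ (by norm_num) (NeZero.ne d)

theorem radiusCoeff_pos [NeZero d] (hε : 0 < ε) : 0 < radiusCoeff d ε := by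
  have hd : 0 < d := NeZero.pos d
  have hK := radiusConst_pos
  unfold radiusCoeff
  positivity

theorem radiusBound_pos (d : ℕ) {C : ℝ} (hC : 0 < C) (hn : 2 ≤ n) : 0 < radiusBound C d n := by
  have hlog : 0 < Real.log n := Real.log_pos (by exact_mod_cast hn)
  unfold radiusBound
  positivity

theorem tendsto_radiusBound [NeZero d] (C : ℝ) :
    Tendsto (fun n => radiusBound C d n) atTop (𝓝 0) := by
  have hlog : Tendsto (fun n : ℕ => Real.log n / n) atTop (𝓝 0) :=
    Real.isLittleO_log_id_atTop.tendsto_div_nhds_zero.comp tendsto_natCast_atTop_atTop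
  have hd : (0 : ℝ) < 1 / d := one_div_pos.2 (Nat.cast_pos.2 (NeZero.pos d))
  have hpow := (hlog.rpow_const (p := 1 / d) (.inr hd.le)).const_mul C
  rwa [Real.zero_rpow hd.ne', mul_zero] at hpow

theorem radiusBound_pow [NeZero d] (hε : 0 < ε) (C : ℝ) :
    radiusBound (C * ε ^ (-2 / (d : ℝ)) * √d) d n ^ d =
      C ^ d * (ε ^ 2)⁻¹ * √d ^ d * (Real.log n / n) := by
  have hd : (d : ℝ) ≠ 0 := NeZero.ne _
  have hlog : 0 ≤ Real.log n / n := div_nonneg (Real.log_natCast_nonneg n) n.cast_nonneg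
  have hεpow : (ε ^ (-2 / (d : ℝ))) ^ d = (ε ^ 2)⁻¹ := by
    rw [← Real.rpow_mul_natCast hε.le, div_mul_cancel₀ _ hd, Real.rpow_neg hε.le, Real.rpow_two]
  have hlogpow : ((Real.log n / n) ^ ((1 : ℝ) / d)) ^ d = Real.log n / n := by
    rw [← Real.rpow_mul_natCast hlog, div_mul_cancel₀ _ hd, Real.rpow_one]
  rw [radiusBound, mul_pow, mul_pow, mul_pow, hεpow, hlogpow]

theorem log_le_of_radiusBound_le [NeZero d] [NeZero n] (hε : 0 < ε)
    (h : radiusBound (radiusCoeff d ε) d n ≤ r) :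
    radiusConst ^ d * (ε ^ 2)⁻¹ * Real.log n ≤ n * cubeVolume d r := by
  have hd : 0 < √(d : ℝ) := Real.sqrt_pos.2 (Nat.cast_pos.2 (NeZero.pos d))
  have hn : (0 : ℝ) < n := Nat.cast_pos.2 (NeZero.pos n)
  have hbound : 0 ≤ radiusBound (radiusCoeff d ε) d n := mul_nonneg (radiusCoeff_pos hε).le
    (Real.rpow_nonneg (div_nonneg (Real.log_natCast_nonneg n) hn.le) _)
  calc radiusConst ^ d * (ε ^ 2)⁻¹ * Real.log n
      = n * (radiusBound (radiusCoeff d ε) d n ^ d / √d ^ d) := by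
        rw [radiusCoeff, radiusBound_pow hε]
        field_simp
    _ ≤ n * (r ^ d / √d ^ d) := by gcongr
    _ = n * cubeVolume d r := by rw [cubeVolume, div_pow]

theorem discRatio_sq (d : ℕ) (ε : ℝ) : discRatio d ε ^ 2 = ε ^ 2 / (12800 ^ 2 * 1600 ^ d) := by
  have h1600 : (1600 : ℝ) ^ d = (20 ^ d * 2 ^ d) ^ 2 := by
    rw [← mul_pow, ← pow_mul, mul_comm d 2, pow_mul]
    norm_num
  rw [h1600, discRatio, meshRatio]
  field_simp
  ring

theorem two_mul_log_le [NeZero d] [NeZero n] (hε : 0 < ε) (hr : 0 < r)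
    (h : radiusBound (radiusCoeff d ε) d n ≤ r) :
    2 * Real.log n ≤
      n * (discRatio d ε * cubeVolume d r) ^ 2 / (4 * (15 ^ d * cubeVolume d r)) := by
  have hw := cubeVolume_pos d hr
  calc 2 * Real.log n = ε ^ 2 / (4 * 12800 ^ 2 * 24000 ^ d) *
        (8 * 12800 ^ 2 * 24000 ^ d * (ε ^ 2)⁻¹ * Real.log n) := by field_simp; ring
    _ ≤ ε ^ 2 / (4 * 12800 ^ 2 * 24000 ^ d) *
        (radiusConst ^ d * (ε ^ 2)⁻¹ * Real.log n) := by gcongr; exact le_radiusConst_pow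
    _ ≤ ε ^ 2 / (4 * 12800 ^ 2 * 24000 ^ d) * (n * cubeVolume d r) :=
        mul_le_mul_of_nonneg_left (log_le_of_radiusBound_le hε h) (by positivity)
    _ = n * (discRatio d ε * cubeVolume d r) ^ 2 / (4 * (15 ^ d * cubeVolume d r)) := by
        rw [mul_pow, discRatio_sq, show (24000 : ℝ) = 1600 * 15 by norm_num, mul_pow]
        field_simp

theorem one_le_mul_cubeVolume [NeZero d] (hn : 3 ≤ n) (hε : 0 < ε) (hε' : ε ≤ 1 / 2)
    (h : radiusBound (radiusCoeff d ε) d n ≤ r) : 1 ≤ n * cubeVolume d r := by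
  have : NeZero n := ⟨by omega⟩
  have hlog : 1 ≤ Real.log n := by
    rw [Real.le_log_iff_exp_le (Nat.cast_pos.2 (NeZero.pos n))]
    have : (3 : ℝ) ≤ n := mod_cast hn
    linarith [Real.exp_one_lt_d9]
  have hK : 1 ≤ radiusConst ^ d := one_le_pow₀ (by norm_num [radiusConst])
  have hε2 : 1 ≤ (ε ^ 2)⁻¹ :=
    (one_le_inv₀ (by positivity)).2 (pow_le_one₀ hε.le (by linarith))
  exact (one_le_mul_of_one_le_of_one_le (one_le_mul_of_one_le_of_one_le hK hε2) hlog).trans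
    (log_le_of_radiusBound_le hε h)

theorem exp_neg_le_one_div_sq [NeZero d] [NeZero n] (hε : 0 < ε) (hr : 0 < r)
    (h : radiusBound (radiusCoeff d ε) d n ≤ r) :
    Real.exp (-(n * (discRatio d ε * cubeVolume d r) ^ 2 / (4 * (15 ^ d * cubeVolume d r)))) ≤
      1 / (n : ℝ) ^ 2 :=
  calc _ ≤ Real.exp (-(2 * Real.log n)) :=
        Real.exp_le_exp.2 (neg_le_neg (two_mul_log_le hε hr h))
    _ = 1 / (n : ℝ) ^ 2 := by
        rw [Real.exp_neg, two_mul, Real.exp_add, Real.exp_log (Nat.cast_pos.2 (NeZero.pos n)),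
          ← sq, one_div]

theorem gridSize_add_one_pow_le [NeZero d] (hn : 3 ≤ n) (hε : 0 < ε) (hε' : ε ≤ 1 / 2)
    (h : radiusBound (radiusCoeff d ε) d n ≤ r) (hr' : r ≤ √d) :
    ((gridSize d ε r : ℝ) + 1) ^ d ≤ (1 / meshRatio d ε + 2) ^ d * n := by
  have hr : 0 < r := (radiusBound_pos d (radiusCoeff_pos hε) (by omega)).trans_le h
  calc ((gridSize d ε r : ℝ) + 1) ^ d
      ≤ (gridSize d ε r + 1) ^ d * (n * cubeVolume d r) :=
        le_mul_of_one_le_right (by positivity) (one_le_mul_cubeVolume hn hε hε' h)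
    _ = (gridSize d ε r + 1) ^ d * cubeVolume d r * n := by ring
    _ ≤ (1 / meshRatio d ε + 2) ^ d * n := by
        gcongr; exact gridSize_add_one_pow_mul_cubeVolume_le hε hr hr'

end Parameters

section Probability

variable {d n : ℕ} {ε : ℝ}

theorem measureReal_not_evenlySpread_gridSize_le [NeZero d] (hn : 3 ≤ n) (hε : 0 < ε)
    (hε' : ε ≤ 1 / 2) {r : ℝ} (h : radiusBound (radiusCoeff d ε) d n ≤ r) (hr' : r ≤ √d) :
    (pointsLaw d n).real
        {X | ¬ EvenlySpread X (gridSize d ε r) r (discRatio d ε * cubeVolume d r)} ≤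
      (1 / meshRatio d ε + 2) ^ d * 2 ^ (2 * windowSize d ε + 1) ^ d * 2 / n := by
  have : NeZero n := ⟨by omega⟩
  have hr : 0 < r := (radiusBound_pos d (radiusCoeff_pos hε) (by omega)).trans_le h
  have hρ := meshRatio_pos d hε
  have hw := cubeVolume_pos d hr
  have hmesh : √d / gridSize d ε r ≤ r := (sqrt_div_gridSize_le hε hr).trans
    (mul_le_of_le_one_left hr.le (by linarith [meshRatio_le d hε.le]))
  have hdisc : discRatio d ε * cubeVolume d r ≤ 2 * (15 ^ d * cubeVolume d r) := by
    rw [← mul_assoc]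
    gcongr
    linarith [discRatio_le d hε, one_le_pow₀ (by norm_num : (1 : ℝ) ≤ 15) (n := d)]
  calc _ ≤ _ := measureReal_not_evenlySpread_le (gridSize_pos hε hr) hr hmesh
        (two_mul_mul_gridSize_add_one_le_windowSize hε hr hr')
        (mul_pos (discRatio_pos d hε) hw).le hdisc
    _ ≤ (1 / meshRatio d ε + 2) ^ d * n * 2 ^ (2 * windowSize d ε + 1) ^ d *
        (2 * (1 / (n : ℝ) ^ 2)) := by
        gcongr
        · exact gridSize_add_one_pow_le hn hε hε' h hr'
        · exact exp_neg_le_one_div_sq hε hr h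
    _ = _ := by field_simp

theorem ae_mem_unitCube (d n : ℕ) : ∀ᵐ X ∂(pointsLaw d n), ∀ i, X i ∈ unitCube d :=
  ae_all_iff.2 fun i => (measurePreserving_eval (fun _ : Fin n => uniformCube d) i)
    |>.quasiMeasurePreserving.ae (ae_restrict_mem (measurableSet_unitCube d))

theorem measureReal_compl_wellSpread_le [NeZero d] (hn : 3 ≤ n) (hε : 0 < ε) (hε' : ε ≤ 1 / 2)
    {r : ℝ} (h : radiusBound (radiusCoeff d ε) d n ≤ r) (hr' : r ≤ √d) :
    (pointsLaw d n).real {X | WellSpread ε r X}ᶜ ≤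
      (1 / meshRatio d ε + 2) ^ d * 2 ^ (2 * windowSize d ε + 1) ^ d * 2 / n := by
  refine (ENNReal.toReal_mono (measure_ne_top _ _) (measure_mono_ae ?_)).trans
    (measureReal_not_evenlySpread_gridSize_le hn hε hε' h hr')
  filter_upwards [ae_mem_unitCube d n] with X hcube hX hspread
  exact hX ⟨hε, hε', (radiusBound_pos d (radiusCoeff_pos hε) (by omega)).trans_le h, hr', hcube,
    hspread⟩

theorem tendsto_measure_of_tendsto_measureReal_compl {ι : Type*} {l : Filter ι} {Ω : ι → Type*}
    [∀ i, MeasurableSpace (Ω i)] {μ : ∀ i, Measure (Ω i)} [∀ i, IsProbabilityMeasure (μ i)]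
    {S : ∀ i, Set (Ω i)} (h : Tendsto (fun i => (μ i).real (S i)ᶜ) l (𝓝 0)) :
    Tendsto (fun i => μ i (S i)) l (𝓝 1) := by
  have hsub : Tendsto (fun i => 1 - μ i (S i)ᶜ) l (𝓝 1) := by
    have hcompl := (ENNReal.tendsto_toReal_zero_iff fun i => measure_ne_top (μ i) _).1 h
    simpa using ENNReal.Tendsto.sub tendsto_const_nhds hcompl (.inl ENNReal.one_ne_top)
  refine tendsto_of_tendsto_of_tendsto_of_le_of_le hsub tendsto_const_nhds (fun i => ?_)
    fun i => prob_le_one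
  rw [tsub_le_iff_right, ← measure_univ (μ := μ i), ← Set.union_compl_self (S i)]
  exact measure_union_le _ _

theorem tendsto_measure_one_of_eventually_subset {ι : Type*} {l : Filter ι} {Ω : ι → Type*}
    [∀ i, MeasurableSpace (Ω i)] {μ : ∀ i, Measure (Ω i)} [∀ i, IsProbabilityMeasure (μ i)]
    {S T : ∀ i, Set (Ω i)} (h : Tendsto (fun i => μ i (S i)) l (𝓝 1))
    (hST : ∀ᶠ i in l, S i ⊆ T i) : Tendsto (fun i => μ i (T i)) l (𝓝 1) :=
  tendsto_of_tendsto_of_tendsto_of_le_of_le' h tendsto_const_nhds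
    (hST.mono fun _ hi => measure_mono hi) (.of_forall fun _ => prob_le_one)

theorem tendsto_pointsLaw_wellSpread [NeZero d] (hε : 0 < ε) (hε' : ε ≤ 1 / 2) {r : ℕ → ℝ}
    (h : ∀ᶠ n in atTop, radiusBound (radiusCoeff d ε) d n ≤ r n ∧ r n ≤ √d) :
    Tendsto (fun n => pointsLaw d n {X | WellSpread ε (r n) X}) atTop (𝓝 1) := by
  refine tendsto_measure_of_tendsto_measureReal_compl (squeeze_zero'
    (.of_forall fun _ => measureReal_nonneg) ?_ (tendsto_const_div_atTop_nhds_zero_nat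
      ((1 / meshRatio d ε + 2) ^ d * 2 ^ (2 * windowSize d ε + 1) ^ d * 2)))
  filter_upwards [h, eventually_ge_atTop 3] with n hr hn
  exact measureReal_compl_wellSpread_le hn hε hε' hr.1 hr.2

theorem aas_isKConnected [NeZero d] (hε : 0 < ε) (hε' : ε ≤ 1 / 2) {r : ℕ → ℝ}
    (h : ∀ᶠ n in atTop, radiusBound (radiusCoeff d ε) d n ≤ r n ∧ r n ≤ √d) :
    AAS d r fun n G => ∀ H, IsAlphaSubgraph (1 / 2 + ε) H G →
      IsKConnected H ⌈connRatio d ε * r n ^ d * n⌉₊ := by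
  refine tendsto_measure_one_of_eventually_subset (tendsto_pointsLaw_wellSpread hε hε' h) ?_
  filter_upwards [eventually_ge_atTop 2] with n hn X hX H hH
  exact hX.isKConnected hn hH

theorem aas_connected [NeZero d] (hε : 0 < ε) (hε' : ε ≤ 1 / 2) {r : ℕ → ℝ}
    (h : ∀ᶠ n in atTop, radiusBound (radiusCoeff d ε) d n ≤ r n) :
    AAS d r fun _ G => ∀ H, IsAlphaSubgraph (1 / 2 + ε) H G → H.Connected := by
  have hd : 0 < √(d : ℝ) := Real.sqrt_pos.2 (Nat.cast_pos.2 (NeZero.pos d))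
  have hmin : ∀ᶠ n in atTop,
      radiusBound (radiusCoeff d ε) d n ≤ min (r n) √d ∧ min (r n) √d ≤ √d := by
    filter_upwards [h,
      (tendsto_radiusBound (d := d) (radiusCoeff d ε)).eventually_le_const hd] with n hn hn'
    exact ⟨le_min hn hn', min_le_right _ _⟩
  refine tendsto_measure_one_of_eventually_subset (tendsto_pointsLaw_wellSpread hε hε' hmin) ?_
  filter_upwards [eventually_ge_atTop 2] with n hn X hX H hH
  rw [← geomGraph_min_sqrt hX.mem_cube] at hH
  refine (hX.isKConnected hn hH).connected (Nat.ceil_pos.2 ?_)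
  exact mul_pos (mul_pos (connRatio_pos hε) (pow_pos hX.radius_pos d))
    (Nat.cast_pos.2 (by omega))

end Probability

end RGG

theorem theorem3p1 :
    ∃ K : ℝ, 0 < K ∧
      ∀ ε : ℝ, 0 < ε → ε ≤ 1 / 2 → ∀ d : ℕ, 1 ≤ d →
        ∃ c₁ C₁ : ℝ, 0 < c₁ ∧ 0 < C₁ ∧
          C₁ = K * ε ^ (-2 / (d : ℝ)) * Real.sqrt (d : ℝ) ∧
          (∀ r : ℕ → ℝ,
            (∀ᶠ n in atTop, RGG.radiusBound C₁ d n ≤ r n ∧ r n ≤ Real.sqrt (d : ℝ)) →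
            RGG.AAS d r (fun n G => ∀ H : SimpleGraph (Fin n),
              RGG.IsAlphaSubgraph (1 / 2 + ε) H G →
                RGG.IsKConnected H ⌈c₁ * r n ^ d * (n : ℝ)⌉₊)) ∧
          (∀ r : ℕ → ℝ,
            (∀ᶠ n in atTop, RGG.radiusBound C₁ d n ≤ r n) →
            RGG.AAS d r (fun n G => ∀ H : SimpleGraph (Fin n),
              RGG.IsAlphaSubgraph (1 / 2 + ε) H G → H.Connected)) := by
  refine ⟨RGG.radiusConst, RGG.radiusConst_pos, fun ε hε hε' d hd => ?_⟩
  have : NeZero d := ⟨by omega⟩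
  exact ⟨RGG.connRatio d ε, RGG.radiusCoeff d ε, RGG.connRatio_pos hε, RGG.radiusCoeff_pos hε, rfl,
    fun _ hr => RGG.aas_isKConnected hε hε' hr, fun _ hr => RGG.aas_connected hε hε' hr⟩
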